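/- Let $a\in\mathbb R$, let $L^a=x^2\partial_x^2+x\partial_x-a^2x^2$ on $\mathbb R^+=(0,\infty)$, and let $u_0\in C_0^\infty(\mathbb R^+)$ be complex valued. A classical solution of the heat Cauchy problem $$L^a u(t,x)=\partial_t u(t,x)\quad (t,x)\in\mathbb R^+\times\mathbb R^+,\qquad u(0,x)=u_0(x),$$ is a function $u$ on $\mathbb R^+\times\mathbb R^+$ for which $\partial_t u,\ \partial_x u,\ \partial_x^2u$ exist and are continuous, which satisfies the equation, and for which $u(t,x)\to u_0(x_0)$ as $(t,x)\to(0^+,x_0)$, for every $x_0>0$. For $t,x,x'>0$ put $$K_a(t,x,x')=\frac{1}{4\sqrt\pi\,t^{3/2}}\int_{\left\{s\ge 0\,:\,\cosh^2\frac s2\ge\frac{(x+x')^2}{4xx'}\right\}} s\,e^{-s^2/4t}\,J_0\!\left(|a|\sqrt{4xx'\cosh^2\tfrac s2-(x+x')^2}\right)ds,$$ where $J_0$ is the Bessel function of the first kind of order $0$. The integral converges absolutely; the $s$-integral runs over the $s\ge 0$ for which the square root is real, i.e. over $s\ge|\ln x-\ln x'|$. (i) The function $$u(t,x)=\int_0^\infty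 K_a(t,x,x')\,u_0(x')\,\frac{dx'}{x'}$$ (an absolutely convergent integral) is a classical solution of this problem; it is bounded on $\mathbb R^+\times\mathbb R^+$, and it is the only classical solution $v$ such that for every $T>0$ there are constants $C,c$ with $|v(t,x)|\le C e^{c(\ln x)^2}$ for all $0<t\le T$, $x>0$. In particular it is the unique bounded classical solution. (ii) $K_a$ is obtained from the heat kernel of the hyperbolic plane by a partial Fourier transform: for $z=x_1+ix$, $z'=x_1'+ix'$ in the upper half plane, $$K_a(t,x,x')=\frac1{\sqrt{xx'}}\int_{-\infty}^{\infty}e^{-ia(x_1-x_1')}\,H_2(t,z,z')\,dx_1,$$ where the integral converges absolutely and, with $\rho$ the hyperbolic distance of $z$ and $z'$, $$H_2(t,z,z')=\int_\rho^\infty\frac{s\,e^{-s^2/4t}}{(4\pi t)^{3/2}\sqrt{\cosh^2\frac s2-\cosh^2\frac\rho2}}\,ds$$ (also absolutely convergent) is the heat kernel of the hyperbolic plane for the shifted Laplace-Beltrami operator $x_2^2(\partial_{x_1}^2+\partial_{x_2}^2)+\frac14$. -/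

import Mathlib

noncomputable section

/-- The Bessel function of the first kind of order zero, by its power series. -/
def besselJ0 (z : ℝ) : ℝ :=
  ∑' k : ℕ, (-1 : ℝ) ^ k / ((k.factorial : ℝ) ^ 2) * (z / 2) ^ (2 * k)

/-- The Bessel operator `L^a = x² ∂ₓ² + x ∂ₓ - a² x²`, applied to `f` at the point `x`. -/
def besselOp (a : ℝ) (f : ℝ → ℂ) (x : ℝ) : ℂ :=
  (x : ℂ) ^ 2 * deriv (deriv f) x + (x : ℂ) * deriv f x - (a : ℂ) ^ 2 * (x : ℂ) ^ 2 * f x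

/-- `u` is a classical solution of the heat Cauchy problem `L^a u = ∂ₜ u` on
`(0,∞) × (0,∞)` with initial value `u₀`: the derivatives `∂ₜ u`, `∂ₓ u`, `∂ₓ² u` exist and are
(jointly) continuous for `t > 0`, `x > 0`, the equation holds there, and `u(t, x) → u₀(x₀)` as
`(t, x) → (0+, x₀)`, for every `x₀ > 0`. The values of `u` for `t ≤ 0` or `x ≤ 0` are
irrelevant. -/
structure IsHeatBesselSolution (a : ℝ) (u₀ : ℝ → ℂ) (u : ℝ → ℝ → ℂ) : Prop where
  diff_t : ∀ t x : ℝ, 0 < t → 0 < x → DifferentiableAt ℝ (fun τ => u τ x) t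
  diff_x : ∀ t x : ℝ, 0 < t → 0 < x → DifferentiableAt ℝ (u t) x
  diff_xx : ∀ t x : ℝ, 0 < t → 0 < x → DifferentiableAt ℝ (deriv (u t)) x
  cont_t : ContinuousOn (fun p : ℝ × ℝ => deriv (fun τ => u τ p.2) p.1)
    (Set.Ioi 0 ×ˢ Set.Ioi 0)
  cont_x : ContinuousOn (fun p : ℝ × ℝ => deriv (u p.1) p.2) (Set.Ioi 0 ×ˢ Set.Ioi 0)
  cont_xx : ContinuousOn (fun p : ℝ × ℝ => deriv (deriv (u p.1)) p.2) (Set.Ioi 0 ×ˢ Set.Ioi 0)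
  heat : ∀ t x : ℝ, 0 < t → 0 < x → besselOp a (u t) x = deriv (fun τ => u τ x) t
  initial : ∀ x₀ : ℝ, 0 < x₀ →
    Filter.Tendsto (fun p : ℝ × ℝ => u p.1 p.2) (nhdsWithin 0 (Set.Ioi 0) ×ˢ nhds x₀)
      (nhds (u₀ x₀))

/-- Gaussian growth in the variable `log x`, uniformly on every bounded time interval. -/
def HasLogGaussianGrowth (u : ℝ → ℝ → ℂ) : Prop :=
  ∀ T : ℝ, 0 < T → ∃ C c : ℝ, ∀ t x : ℝ, 0 < t → t ≤ T → 0 < x →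
    ‖u t x‖ ≤ C * Real.exp (c * (Real.log x) ^ 2)

/-- The range of the variable `s` in the kernel: the `s ≥ 0` for which the square root in
`heatBesselIntegrand` has a nonnegative argument. -/
def heatBesselRange (x x' : ℝ) : Set ℝ :=
  {s : ℝ | 0 ≤ s ∧ (x + x') ^ 2 / (4 * x * x') ≤ Real.cosh (s / 2) ^ 2}

/-- The integrand of the heat kernel of `L^a`. -/
def heatBesselIntegrand (a t x x' s : ℝ) : ℝ :=
  s * Real.exp (-s ^ 2 / (4 * t)) *
    besselJ0 (|a| * Real.sqrt (4 * x * x' * Real.cosh (s / 2) ^ 2 - (x + x') ^ 2))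

/-- The heat kernel of `L^a`, with respect to the measure `dx' / x'`. -/
def heatBesselKernel (a t x x' : ℝ) : ℝ :=
  1 / (4 * Real.sqrt Real.pi * t ^ (3 / 2 : ℝ)) *
    ∫ s in heatBesselRange x x', heatBesselIntegrand a t x x' s

/-- The function `u(t, x) = ∫₀^∞ K_a(t, x, x') u₀(x') dx' / x'`. -/
def heatBesselFlow (a : ℝ) (u₀ : ℝ → ℂ) (t x : ℝ) : ℂ :=
  ∫ x' in Set.Ioi (0 : ℝ), (heatBesselKernel a t x x' : ℂ) * u₀ x' / (x' : ℂ)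

/-- The integrand of the heat kernel of the hyperbolic plane, at hyperbolic distance `ρ`. -/
def hyperbolicHeatIntegrand (t ρ s : ℝ) : ℝ :=
  s * Real.exp (-s ^ 2 / (4 * t)) /
    ((4 * Real.pi * t) ^ (3 / 2 : ℝ) *
      Real.sqrt (Real.cosh (s / 2) ^ 2 - Real.cosh (ρ / 2) ^ 2))

/-- The heat kernel of the hyperbolic plane, for the shifted Laplace-Beltrami operator
`y² (∂ₓ² + ∂ᵧ²) + 1/4` on the upper half plane. -/
def hyperbolicHeatKernel (t : ℝ) (z z' : UpperHalfPlane) : ℝ :=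
  ∫ s in Set.Ioi (dist z z'), hyperbolicHeatIntegrand t (dist z z') s

end

/-! In the variable `w = log x` the operator `L^a` becomes `∂_w² - a² e^{2w}`, and its heat flow is
obtained from its wave flow. Let `W(s, x)` solve `∂ₛ² W = L^a W` with `W = 0` and `∂ₛ W = u₀` at `s
= 0`. Riemann's method gives `W` as half the integral of `J₀(|a| √(2 x x' cosh s - x² - x'²)) u₀(x')
dx'/x'` over `x e⁻ˢ ≤ x' ≤ x eˢ`; the root is the one in `K_a`, since `4 x x' cosh²(s/2) - (x + x')²
= 2 x x' cosh s - x² - x'²`. The weight `k(t, s) = s e^{-s²/4t} / (2 √π t^{3/2})` satisfies `∂ₜ k =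
∂ₛ² k` and `k(t, 0) = 0`. Two integrations by parts therefore show that `∫₀^∞ k W ds` solves the
heat equation (`IsWaveSolution.heatTransform_heatWeightT`), and Fubini identifies this integral with
the flow of the kernel (`heatBesselFlow_eq_heatTransform`).

The wave equation for `W` follows from that of the Riemann function (`riemannKernel_wave`) and from
the matching of the boundary terms on the characteristics (`waveSS_eq`). Working with the entire
functions `φ_j` of `besselClifford`, where `J₀(z) = φ₀(z²/4)`, avoids the square root. An energy
inequality bounds `φ₀`, `φ₁`, `φ₂` on `[0, ∞)`, so that `W` and the derivatives used grow at most
exponentially in `s`, which the Gaussian absorbs.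

For boundedness and the initial value one writes `W = s Q`, where `Q` is a mean of `J₀ · u₀` over
the cone slice and `Q(0, x) = u₀(x)`. With `s = √t σ` the flow is the average of `Q(√t σ, x)`
against a probability density in `σ` (`heatBesselFlow_eq_integral_waveMean`).

Uniqueness is a maximum principle for `∂ₜ = ∂_w² - q` with `q ≥ 0`: a Gaussian barrier excludes
nonzero solutions for a short time, and finitely many such steps cover `(0, T]`.

The Fourier formula is Fubini again: for fixed `s`, the `y`-integral of `e^{-iay} / √(R² - y²)` over
`(-R, R)` equals `π J₀(aR)` by Poisson's formula. -/

noncomputable section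

open Filter Topology Set

/-! ### Bessel–Clifford functions: derivatives, recurrence and bounds. -/

/-- The Bessel–Clifford function of order `j`, in the sign convention for which
`J₀(z) = besselClifford 0 (z² / 4)`. -/
def besselClifford (j : ℕ) (q : ℝ) : ℝ :=
  ∑' k : ℕ, (-q) ^ k / ((k.factorial : ℝ) * ((k + j).factorial : ℝ))

theorem summable_besselClifford (j : ℕ) (q : ℝ) :
    Summable fun k : ℕ => (-q) ^ k / ((k.factorial : ℝ) * ((k + j).factorial : ℝ)) := by
  refine Summable.of_norm_bounded (g := fun k : ℕ => |q| ^ k / (k.factorial : ℝ))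
    (Real.summable_pow_div_factorial |q|) fun k => ?_
  rw [norm_div, norm_pow, norm_neg, Real.norm_eq_abs, norm_mul, Real.norm_natCast,
    Real.norm_natCast]
  have h1 : (0 : ℝ) < k.factorial := by positivity
  have h2 : (1 : ℝ) ≤ (k + j).factorial := by exact_mod_cast Nat.factorial_pos _
  gcongr
  nlinarith

/-- Termwise differentiation shifts the series by one index. All derivatives of the Riemann function
thus stay in this family. -/
theorem hasDerivAt_besselClifford (j : ℕ) (q : ℝ) :
    HasDerivAt (besselClifford j) (-besselClifford (j + 1) q) q := by
  set R : ℝ := |q| + 1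
  have hR : 0 ≤ R := by positivity
  let g : ℕ → ℝ → ℝ := fun k x => (-x) ^ k / ((k.factorial : ℝ) * ((k + j).factorial : ℝ))
  let g' : ℕ → ℝ → ℝ := fun k x =>
    (k : ℝ) * (-x) ^ (k - 1) * (-1) / ((k.factorial : ℝ) * ((k + j).factorial : ℝ))
  have hg : ∀ k x, HasDerivAt (g k) (g' k x) x := by
    intro k x
    simpa [g, g'] using ((hasDerivAt_neg x).pow k).div_const
      ((k.factorial : ℝ) * ((k + j).factorial : ℝ))
  have hu : Summable fun k : ℕ => R ^ (k - 1) / ((k - 1).factorial : ℝ) := by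
    rw [← summable_nat_add_iff 1]
    simpa using Real.summable_pow_div_factorial R
  have hbd : ∀ k x, x ∈ Metric.ball (0 : ℝ) R →
      ‖g' k x‖ ≤ R ^ (k - 1) / ((k - 1).factorial : ℝ) := by
    intro k x hx
    have hx' : |x| ≤ R := by simpa using (mem_ball_zero_iff.1 hx).le
    rcases k with _ | k
    · simp [g']
    · simp only [g', norm_div, norm_mul, norm_pow, norm_neg, Real.norm_eq_abs,
        Nat.add_sub_cancel, Nat.abs_cast, abs_one, mul_one]
      have h2 : (1 : ℝ) ≤ (k + 1 + j).factorial := by exact_mod_cast Nat.factorial_pos _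
      have h1 : (0 : ℝ) < k.factorial := by positivity
      have h3 : ((k + 1).factorial : ℝ) = (k + 1 : ℕ) * k.factorial := by
        exact_mod_cast Nat.factorial_succ k
      have h4 : (0 : ℝ) < (k + 1 : ℕ) := by positivity
      rw [h3, mul_assoc ((k + 1 : ℕ) : ℝ), mul_div_mul_left _ _ h4.ne']
      gcongr
      nlinarith
  have h := hasDerivAt_tsum_of_isPreconnected (g := g) (g' := g') (y₀ := 0) (y := q) hu
    Metric.isOpen_ball (convex_ball (0 : ℝ) R).isPreconnected (fun k x _ => hg k x) hbd
    (by simp [R]; positivity) (by simpa [g] using summable_besselClifford j 0)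
    (by simp [R])
  have hs : (∑' k, g' k q) = -besselClifford (j + 1) q := by
    have hsum : Summable fun k => g' k q :=
      Summable.of_norm_bounded hu fun k => hbd k q (by simp [R])
    rw [hsum.tsum_eq_zero_add]
    simp only [g', besselClifford, Nat.cast_zero, zero_mul, zero_div, zero_add,
      Nat.add_sub_cancel, ← tsum_neg]
    refine tsum_congr fun k => ?_
    have h3 : ((k + 1).factorial : ℝ) = (k + 1 : ℕ) * k.factorial := by
      exact_mod_cast Nat.factorial_succ k
    have h1 : (0 : ℝ) < k.factorial := by positivity
    have h4 : (0 : ℝ) < (k + 1 : ℕ) := by positivity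
    have h5 : (0 : ℝ) < (k + 1 + j).factorial := by positivity
    rw [h3, show k + (j + 1) = k + 1 + j by ring]
    field_simp
  rw [hs] at h
  exact h

theorem continuous_besselClifford (j : ℕ) : Continuous (besselClifford j) :=
  continuous_iff_continuousAt.2 fun q => (hasDerivAt_besselClifford j q).continuousAt

/-- This is a comparison of coefficients. With the derivative rule it reads `q φ'' + (j + 1) φ' + φ
= 0`, Bessel's equation in the variable `z²/4`. -/
theorem besselClifford_recurrence (j : ℕ) (q : ℝ) :
    q * besselClifford (j + 2) q = (j + 1) * besselClifford (j + 1) q - besselClifford j q := by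
  have h2 := (summable_besselClifford (j + 2) q).hasSum.mul_left q
  -- The series is shifted by one index to match powers of `q`; the factor `k` kills the new term at
  -- `k = 0`.
  have h2' : HasSum
      (fun k : ℕ => -((-q) ^ k * k / ((k.factorial : ℝ) * ((k + (j + 1)).factorial : ℝ))))
      (q * besselClifford (j + 2) q) := by
    rw [← hasSum_nat_add_iff' 1]
    simp only [Finset.range_one, Finset.sum_singleton, Nat.cast_zero, mul_zero, zero_div, neg_zero,
      sub_zero]
    refine h2.congr_fun fun k => ?_
    have h3 : ((k + 1).factorial : ℝ) = (k + 1 : ℕ) * k.factorial := by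
      exact_mod_cast Nat.factorial_succ k
    have h4 : (0 : ℝ) < (k + 1 : ℕ) := by positivity
    have h5 : (0 : ℝ) < (k + (j + 2)).factorial := by positivity
    rw [h3, show k + 1 + (j + 1) = k + (j + 2) by ring]
    field_simp
    ring
  have h1 := (summable_besselClifford (j + 1) q).hasSum.mul_left ((j : ℝ) + 1)
  have h0 := (summable_besselClifford j q).hasSum
  refine h2'.unique ((h1.sub h0).congr_fun ?_)
  intro k
  have h3 : ((k + (j + 1)).factorial : ℝ) = (k + j + 1 : ℕ) * (k + j).factorial := by
    exact_mod_cast Nat.factorial_succ (k + j)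
  have h4 : (0 : ℝ) < (k + j + 1 : ℕ) := by positivity
  have h5 : (0 : ℝ) < (k + j).factorial := by positivity
  rw [h3]
  push_cast at h4 ⊢
  field_simp
  ring

theorem besselClifford_zero_zero : besselClifford 0 0 = 1 := by
  rw [besselClifford, tsum_eq_single 0 (by intro k hk; simp [hk])]
  simp

/-- The energy `φ₀² + q φ₁²` is nonincreasing for `q ≥ 0`. -/
theorem besselClifford_energy_le {q : ℝ} (hq : 0 ≤ q) :
    besselClifford 0 q ^ 2 + q * besselClifford 1 q ^ 2 ≤ 1 := by
  let E : ℝ → ℝ := fun q => besselClifford 0 q ^ 2 + q * besselClifford 1 q ^ 2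
  have hE : ∀ q, HasDerivAt E (-besselClifford 1 q ^ 2) q := by
    intro q
    have h := ((hasDerivAt_besselClifford 0 q).pow 2).add
      ((hasDerivAt_id q).mul ((hasDerivAt_besselClifford 1 q).pow 2))
    refine h.congr_deriv ?_
    have hr := besselClifford_recurrence 0 q
    simp only [zero_add, Nat.cast_zero, one_mul, id, Pi.pow_apply] at hr ⊢
    push_cast
    -- The recurrence of order 0 cancels the cross terms `φ₀ φ₁` and leaves `-φ₁²`.
    linear_combination (-2 * besselClifford 1 q) * hr
  have hanti : Antitone E := antitone_of_hasDerivAt_nonpos hE fun q => by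
    have := sq_nonneg (besselClifford 1 q)
    simpa using this
  have := hanti hq
  simpa [E, besselClifford_zero_zero] using this

theorem abs_besselClifford_zero_le {q : ℝ} (hq : 0 ≤ q) : |besselClifford 0 q| ≤ 1 := by
  have h := besselClifford_energy_le hq
  have h1 : 0 ≤ q * besselClifford 1 q ^ 2 := by positivity
  exact abs_le_one_iff_mul_self_le_one.2 (by nlinarith)

/-- On `[0, 1]` compactness suffices. For `q ≥ 1` the energy gives `q φ₁² ≤ 1`, and the recurrence
gives `q |φ₂| ≤ |φ₁| + |φ₀| ≤ 2`. -/
theorem exists_abs_besselClifford_le :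
    ∃ B : ℝ, 0 ≤ B ∧ ∀ q : ℝ, 0 ≤ q →
      |besselClifford 1 q| ≤ B ∧ |besselClifford 2 q| ≤ B := by
  obtain ⟨C₁, h₁⟩ := (isCompact_Icc (a := (0 : ℝ)) (b := 1)).exists_bound_of_continuousOn
    (continuous_besselClifford 1).continuousOn
  obtain ⟨C₂, h₂⟩ := (isCompact_Icc (a := (0 : ℝ)) (b := 1)).exists_bound_of_continuousOn
    (continuous_besselClifford 2).continuousOn
  refine ⟨max (max C₁ C₂) 2, by positivity, fun q hq => ?_⟩
  rcases le_total q 1 with h | h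
  · exact ⟨(h₁ q ⟨hq, h⟩).trans (by simp), (h₂ q ⟨hq, h⟩).trans (by simp)⟩
  · have hE := besselClifford_energy_le hq
    have h0 := abs_besselClifford_zero_le hq
    have h1 : |besselClifford 1 q| ≤ 1 := by
      refine abs_le_one_iff_mul_self_le_one.2 ?_
      nlinarith [sq_nonneg (besselClifford 0 q), sq_nonneg (besselClifford 1 q)]
    have h2 : |besselClifford 2 q| ≤ 2 := by
      have hr := besselClifford_recurrence 0 q
      simp only [zero_add, Nat.cast_zero, one_mul] at hr
      have h3 : q * |besselClifford 2 q| ≤ 2 := by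
        rw [← abs_of_nonneg hq, ← abs_mul, abs_of_nonneg hq, hr]
        exact (abs_sub _ _).trans (by linarith)
      nlinarith [abs_nonneg (besselClifford 2 q)]
    exact ⟨h1.trans (le_max_of_le_right (by norm_num)), h2.trans (le_max_right _ _)⟩

theorem besselJ0_eq (z : ℝ) : besselJ0 z = besselClifford 0 (z ^ 2 / 4) := by
  rw [besselJ0, besselClifford]
  refine tsum_congr fun k => ?_
  rw [neg_pow (z ^ 2 / 4), pow_mul, add_zero, show (z / 2) ^ 2 = z ^ 2 / 4 by ring, pow_two
    (k.factorial : ℝ)]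
  exact div_mul_eq_mul_div _ _ _

theorem besselJ0_abs_mul_sqrt (a : ℝ) {m : ℝ} (hm : 0 ≤ m) :
    besselJ0 (|a| * Real.sqrt m) = besselClifford 0 (a ^ 2 / 4 * m) := by
  rw [besselJ0_eq, mul_pow, sq_abs, Real.sq_sqrt hm]
  ring_nf

theorem abs_besselJ0_le_one (z : ℝ) : |besselJ0 z| ≤ 1 := by
  rw [besselJ0_eq]
  exact abs_besselClifford_zero_le (by positivity)

theorem continuous_besselJ0 : Continuous besselJ0 := by
  have : besselJ0 = fun z => besselClifford 0 (z ^ 2 / 4) := funext besselJ0_eq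
  rw [this]
  exact (continuous_besselClifford 0).comp (by fun_prop)

end

/-! ### Poisson's integral and the Fourier transform of `1 / √(R² - y²)`. -/

noncomputable section

open MeasureTheory Set Real

theorem integral_cos_pow_zero_pi (n : ℕ) :
    ∫ θ in (0 : ℝ)..π, cos θ ^ (n + 2) = (n + 1) / (n + 2) * ∫ θ in (0 : ℝ)..π, cos θ ^ n := by
  rw [integral_cos_pow]
  simp

theorem integral_cos_pow_odd_zero_pi (k : ℕ) : ∫ θ in (0 : ℝ)..π, cos θ ^ (2 * k + 1) = 0 := by
  induction k with
  | zero => simp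
  | succ k ih => rw [show 2 * (k + 1) + 1 = 2 * k + 1 + 2 by ring, integral_cos_pow_zero_pi, ih,
      mul_zero]

theorem integral_cos_pow_even_zero_pi (k : ℕ) :
    ∫ θ in (0 : ℝ)..π, cos θ ^ (2 * k) =
      π * ((2 * k).factorial / (4 ^ k * (k.factorial : ℝ) ^ 2)) := by
  induction k with
  | zero => simp
  | succ k ih =>
    rw [show 2 * (k + 1) = 2 * k + 2 by ring, integral_cos_pow_zero_pi, ih, Nat.factorial_succ,
      Nat.factorial_succ (2 * k), Nat.factorial_succ k]
    have : (k.factorial : ℝ) ≠ 0 := by positivity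
    push_cast
    field_simp
    ring

/-- Poisson's integral representation of the Bessel function `J₀`. -/
theorem integral_cexp_mul_cos (c : ℝ) :
    ∫ θ in (0 : ℝ)..π, Complex.exp (-Complex.I * c * (cos θ : ℝ)) = π * besselJ0 c := by
  have h1 : HasSum (fun n : ℕ => ∫ θ in (0 : ℝ)..π,
      (-Complex.I * c * (cos θ : ℝ)) ^ n / (n.factorial : ℂ))
      (∫ θ in (0 : ℝ)..π, Complex.exp (-Complex.I * c * (cos θ : ℝ))) := by
    refine intervalIntegral.hasSum_integral_of_dominated_convergence
      (fun n _ => |c| ^ n / (n.factorial : ℝ)) (fun n => ?_) (fun n => ?_) ?_ ?_ ?_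
    · exact Continuous.aestronglyMeasurable (by fun_prop)
    · refine Filter.Eventually.of_forall fun θ _ => ?_
      simp only [norm_div, norm_pow, norm_mul, norm_neg, Complex.norm_I, one_mul,
        Complex.norm_real, Complex.norm_natCast, Real.norm_eq_abs]
      gcongr
      exact mul_le_of_le_one_right (abs_nonneg _) (abs_cos_le_one θ)
    · exact Filter.Eventually.of_forall fun θ _ => Real.summable_pow_div_factorial _
    · exact intervalIntegrable_const
    · refine Filter.Eventually.of_forall fun θ _ => ?_
      rw [Complex.exp_eq_exp_ℂ]
      exact NormedSpace.expSeries_div_hasSum_exp _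
  have h2 : ∀ n : ℕ, (∫ θ in (0 : ℝ)..π,
      (-Complex.I * c * (cos θ : ℝ)) ^ n / (n.factorial : ℂ)) =
      (-Complex.I * c) ^ n / (n.factorial : ℂ) * ((∫ θ in (0 : ℝ)..π, cos θ ^ n : ℝ) : ℂ) := by
    intro n
    rw [← intervalIntegral.integral_ofReal, ← intervalIntegral.integral_const_mul]
    congr 1 with θ
    push_cast
    ring
  simp_rw [h2] at h1
  -- The odd moments of `cos` on `[0, π]` vanish, so the exponential series may be summed over even
  -- indices only.
  have h3 := (Function.Injective.hasSum_iff (g := fun k : ℕ => 2 * k)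
    (fun a b h => by simpa using h) (fun n hn => ?_)).2 h1
  · have h4 := (summable_besselClifford 0 (c ^ 2 / 4)).hasSum.mul_left π
    rw [besselJ0_eq, ← Complex.ofReal_mul]
    refine h3.unique (((Complex.hasSum_ofReal).2 h4).congr_fun fun k => ?_)
    have : (k.factorial : ℂ) ≠ 0 := by exact_mod_cast k.factorial_ne_zero
    have h5 : ((2 * k).factorial : ℂ) ≠ 0 := by exact_mod_cast (2 * k).factorial_ne_zero
    simp only [Function.comp, integral_cos_pow_even_zero_pi, add_zero]
    push_cast
    rw [pow_mul, show (-Complex.I * (c : ℂ)) ^ 2 = -((c : ℂ) ^ 2 / 4) * 4 by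
      rw [mul_pow, neg_sq, Complex.I_sq]; ring, mul_pow]
    field_simp
  · rcases Nat.even_or_odd' n with ⟨k, rfl | rfl⟩
    · exact absurd ⟨k, rfl⟩ hn
    · simp [integral_cos_pow_odd_zero_pi]

theorem image_mul_cos_Ioo {R : ℝ} (hR : 0 < R) :
    (fun θ => R * cos θ) '' Ioo 0 π = Ioo (-R) R := by
  ext y
  constructor
  · rintro ⟨θ, hθ, rfl⟩
    have h1 : cos θ < 1 := by
      simpa using strictAntiOn_cos (left_mem_Icc.2 pi_pos.le) (Ioo_subset_Icc_self hθ) hθ.1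
    have h2 : -1 < cos θ := by
      simpa using strictAntiOn_cos (Ioo_subset_Icc_self hθ) (right_mem_Icc.2 pi_pos.le) hθ.2
    constructor <;> nlinarith
  · rintro ⟨h1, h2⟩
    refine ⟨arccos (y / R), ⟨arccos_pos.2 ((div_lt_one hR).2 h2), ?_⟩, ?_⟩
    · refine lt_of_le_of_ne (arccos_le_pi _) fun h => ?_
      rw [arccos_eq_pi, div_le_iff₀ hR] at h
      linarith
    · have h3 : -1 ≤ y / R := by rw [le_div_iff₀ hR]; linarith
      have h4 : y / R ≤ 1 := by rw [div_le_one hR]; linarith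
      simp only [cos_arccos h3 h4]
      field_simp

/-- The Jacobian `R sin θ` of `y = R cos θ` is exactly the square root, so the substitution removes
the endpoint singularities. -/
theorem abs_deriv_smul_div_sqrt {R : ℝ} (hR : 0 < R) (f : ℝ → ℂ) {θ : ℝ} (hθ : θ ∈ Ioo 0 π) :
    |R * -sin θ| • (f (R * cos θ) / (√(R ^ 2 - (R * cos θ) ^ 2) : ℝ)) = f (R * cos θ) := by
  have hs := sin_pos_of_mem_Ioo hθ
  have h1 : R ^ 2 - (R * cos θ) ^ 2 = (R * sin θ) ^ 2 := by
    have := sin_sq_add_cos_sq θ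
    linear_combination (-R ^ 2) * this
  have h2 : 0 < R * sin θ := by positivity
  rw [h1, sqrt_sq h2.le, mul_neg, abs_neg, abs_of_pos h2, Complex.real_smul]
  have : ((R * sin θ : ℝ) : ℂ) ≠ 0 := by exact_mod_cast h2.ne'
  field_simp

theorem hasDerivWithinAt_mul_cos (R : ℝ) (s : Set ℝ) (θ : ℝ) :
    HasDerivWithinAt (fun θ => R * cos θ) (R * -sin θ) s θ :=
  ((hasDerivAt_cos θ).const_mul R).hasDerivWithinAt

theorem injOn_mul_cos {R : ℝ} (hR : 0 < R) : InjOn (fun θ => R * cos θ) (Ioo 0 π) := by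
  intro x hx y hy h
  exact injOn_cos (Ioo_subset_Icc_self hx) (Ioo_subset_Icc_self hy) (mul_left_cancel₀ hR.ne' h)

theorem integrableOn_div_sqrt_sq_sub_sq {R : ℝ} (hR : 0 < R) {f : ℝ → ℂ} (hf : Continuous f) :
    IntegrableOn (fun y => f y / (√(R ^ 2 - y ^ 2) : ℝ)) (Ioo (-R) R) := by
  rw [← image_mul_cos_Ioo hR, integrableOn_image_iff_integrableOn_abs_deriv_smul measurableSet_Ioo
    (fun θ _ => hasDerivWithinAt_mul_cos R _ θ) (injOn_mul_cos hR)]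
  refine IntegrableOn.congr_fun (f := fun θ => f (R * cos θ)) ?_
    (fun θ hθ => (abs_deriv_smul_div_sqrt hR f hθ).symm) measurableSet_Ioo
  exact ((hf.comp (by fun_prop)).integrableOn_Icc (a := 0) (b := π)).mono_set Ioo_subset_Icc_self

theorem integral_div_sqrt_sq_sub_sq {R : ℝ} (hR : 0 < R) (f : ℝ → ℂ) :
    ∫ y in Ioo (-R) R, f y / (√(R ^ 2 - y ^ 2) : ℝ) = ∫ θ in (0 : ℝ)..π, f (R * cos θ) := by
  rw [← image_mul_cos_Ioo hR, integral_image_eq_integral_abs_deriv_smul measurableSet_Ioo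
    (fun θ _ => hasDerivWithinAt_mul_cos R _ θ) (injOn_mul_cos hR),
    intervalIntegral.integral_of_le pi_pos.le, integral_Ioc_eq_integral_Ioo]
  exact setIntegral_congr_fun measurableSet_Ioo fun θ hθ => abs_deriv_smul_div_sqrt hR f hθ

theorem integral_cexp_div_sqrt {R : ℝ} (hR : 0 < R) (a : ℝ) :
    ∫ y in Ioo (-R) R, Complex.exp (-Complex.I * a * y) / (√(R ^ 2 - y ^ 2) : ℝ) =
      π * besselJ0 (a * R) := by
  rw [integral_div_sqrt_sq_sub_sq hR fun y => Complex.exp (-Complex.I * a * y),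
    ← integral_cexp_mul_cos]
  congr 1 with θ
  push_cast
  ring_nf

theorem integral_one_div_sqrt_sq_sub_sq {R : ℝ} (hR : 0 < R) :
    ∫ y in Ioo (-R) R, 1 / √(R ^ 2 - y ^ 2) = π := by
  have h := integral_div_sqrt_sq_sub_sq hR fun _ => (1 : ℂ)
  apply Complex.ofReal_injective
  rw [← integral_complex_ofReal]
  simpa using h

end

/-! ### The hyperbolic heat kernel and its partial Fourier transform. -/

noncomputable section

open MeasureTheory Set Real

theorem integrable_mul_exp_neg_sq_div {t : ℝ} (ht : 0 < t) :
    Integrable fun s : ℝ => s * exp (-s ^ 2 / (4 * t)) := by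
  refine (integrable_mul_exp_neg_mul_sq (b := 1 / (4 * t)) (by positivity)).congr
    (Filter.Eventually.of_forall fun s => ?_)
  simp only
  congr 2
  ring

theorem measurableSet_heatBesselRange (x x' : ℝ) : MeasurableSet (heatBesselRange x x') := by
  have h : heatBesselRange x x' =
      Ici 0 ∩ {s | (x + x') ^ 2 / (4 * x * x') ≤ cosh (s / 2) ^ 2} := by
    ext s
    rfl
  rw [h]
  exact measurableSet_Ici.inter (measurableSet_le measurable_const (by fun_prop))

theorem continuous_heatBesselIntegrand (a t x x' : ℝ) :
    Continuous (heatBesselIntegrand a t x x') := by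
  have := continuous_besselJ0
  unfold heatBesselIntegrand
  fun_prop

theorem integrable_heatBesselIntegrand (a x x' : ℝ) {t : ℝ} (ht : 0 < t) :
    Integrable (heatBesselIntegrand a t x x') := by
  refine (integrable_mul_exp_neg_sq_div ht).mono
    (continuous_heatBesselIntegrand a t x x').aestronglyMeasurable
    (Filter.Eventually.of_forall fun s => ?_)
  rw [heatBesselIntegrand, norm_mul]
  exact mul_le_of_le_one_right (norm_nonneg _) (abs_besselJ0_le_one _)

theorem cosh_half_sq_sub (s ρ : ℝ) :
    cosh (s / 2) ^ 2 - cosh (ρ / 2) ^ 2 = sinh ((s + ρ) / 2) * sinh ((s - ρ) / 2) := by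
  rw [add_div, sub_div, sinh_add, sinh_sub]
  have h1 := cosh_sq (s / 2)
  have h2 := cosh_sq (ρ / 2)
  linear_combination cosh (ρ / 2) ^ 2 * h1 - cosh (s / 2) ^ 2 * h2

/-- The difference of squares factors into two values of `sinh`, each at least its argument. The
singularity at `s = ρ` is thereby compared with that of `s / √(s² - ρ²)`, which has an elementary
primitive. -/
theorem half_sqrt_le_sqrt_cosh {ρ s : ℝ} (hρ : 0 ≤ ρ) (hs : ρ < s) :
    √(s ^ 2 - ρ ^ 2) / 2 ≤ √(cosh (s / 2) ^ 2 - cosh (ρ / 2) ^ 2) := by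
  rw [show √(s ^ 2 - ρ ^ 2) / 2 = √((s ^ 2 - ρ ^ 2) / 4) by
    rw [sqrt_div' _ (by norm_num), show (4 : ℝ) = 2 ^ 2 by norm_num, sqrt_sq (by norm_num)]]
  refine sqrt_le_sqrt ?_
  rw [cosh_half_sq_sub]
  have h1 : (s + ρ) / 2 ≤ sinh ((s + ρ) / 2) := self_le_sinh_iff.2 (by linarith)
  have h2 : (s - ρ) / 2 ≤ sinh ((s - ρ) / 2) := self_le_sinh_iff.2 (by linarith)
  calc (s ^ 2 - ρ ^ 2) / 4 = (s + ρ) / 2 * ((s - ρ) / 2) := by ring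
    _ ≤ _ := mul_le_mul h1 h2 (by linarith) (by linarith)

theorem integrableOn_hyperbolicHeatIntegrand {t ρ : ℝ} (ht : 0 < t) (hρ : 0 ≤ ρ) :
    IntegrableOn (hyperbolicHeatIntegrand t ρ) (Ioi ρ) := by
  set c : ℝ := (4 * π * t) ^ (3 / 2 : ℝ) with hc
  have hc0 : 0 < c := by positivity
  have hmeas : Measurable (hyperbolicHeatIntegrand t ρ) := by
    unfold hyperbolicHeatIntegrand
    fun_prop
  have hbound : ∀ s, ρ < s → ‖hyperbolicHeatIntegrand t ρ s‖ ≤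
      2 / c * (s * exp (-s ^ 2 / (4 * t)) / √(s ^ 2 - ρ ^ 2)) := by
    intro s hs
    have hs0 : 0 < s := hρ.trans_lt hs
    have h1 := half_sqrt_le_sqrt_cosh hρ hs
    have h2 : 0 < √(s ^ 2 - ρ ^ 2) := sqrt_pos.2 (by nlinarith)
    rw [hyperbolicHeatIntegrand, ← hc, Real.norm_of_nonneg (by positivity)]
    calc _ ≤ s * exp (-s ^ 2 / (4 * t)) / (c * (√(s ^ 2 - ρ ^ 2) / 2)) := by gcongr
      _ = _ := by field_simp
  -- Near `ρ` the comparison function is the derivative of `√(s² - ρ²)`; beyond `ρ + 1` that root is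
  -- at least 1 and the Gaussian takes over.
  rw [← Ioc_union_Ioi_eq_Ioi (show ρ ≤ ρ + 1 by linarith)]
  refine IntegrableOn.union ?_ ?_
  · have h : IntegrableOn (fun s => s / √(s ^ 2 - ρ ^ 2)) (Ioc ρ (ρ + 1)) := by
      refine intervalIntegral.integrableOn_deriv_of_nonneg (g := fun s => √(s ^ 2 - ρ ^ 2))
        (by fun_prop) (fun s hs => ?_) (fun s hs => ?_)
      · have h2 : s ^ 2 - ρ ^ 2 ≠ 0 := by nlinarith [hs.1]
        refine (((hasDerivAt_pow 2 s).sub_const (ρ ^ 2)).sqrt h2).congr_deriv ?_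
        simp only [Nat.cast_ofNat, Nat.add_one_sub_one, pow_one]
        rw [mul_div_mul_left _ _ two_ne_zero]
      · have : 0 < s := hρ.trans_lt hs.1
        positivity
    refine (h.const_mul (2 / c)).mono' hmeas.aestronglyMeasurable
      ((ae_restrict_iff' measurableSet_Ioc).2 (Filter.Eventually.of_forall fun s hs => ?_))
    refine (hbound s hs.1).trans ?_
    have hs0 : 0 < s := hρ.trans_lt hs.1
    have : exp (-s ^ 2 / (4 * t)) ≤ 1 := by
      rw [exp_le_one_iff, neg_div]
      exact neg_nonpos.2 (by positivity)
    gcongr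
    exact mul_le_of_le_one_right hs0.le this
  · refine ((integrable_mul_exp_neg_sq_div ht).integrableOn.const_mul (2 / c)).mono'
      hmeas.aestronglyMeasurable
      ((ae_restrict_iff' measurableSet_Ioi).2 (Filter.Eventually.of_forall fun s hs => ?_))
    have hs' : ρ + 1 < s := hs
    refine (hbound s (by linarith)).trans ?_
    have hs0 : 0 < s := by linarith
    have h1 : 1 ≤ √(s ^ 2 - ρ ^ 2) := one_le_sqrt.2 (by nlinarith)
    gcongr
    exact div_le_self (by positivity) h1

/-- `4 x x' cosh² (s / 2) - (x + x')²`, the square of the half-width of the interval of those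
`y` for which `i x'` and `y + i x` have hyperbolic distance less than `s`. -/
def horocyclicSq (x x' s : ℝ) : ℝ := 4 * x * x' * cosh (s / 2) ^ 2 - (x + x') ^ 2

/-- The integrand of the hyperbolic heat kernel in horocyclic coordinates; the denominator is `0`
beyond the hyperbolic distance. -/
def horocyclicIntegrand (t x x' y s : ℝ) : ℝ :=
  2 * √(x * x') / (4 * π * t) ^ (3 / 2 : ℝ) * (s * exp (-s ^ 2 / (4 * t))) *
    (1 / √(horocyclicSq x x' s - y ^ 2))

theorem cosh_half_dist_sq {x x' : ℝ} (y y' : ℝ) (hx : 0 < x) (hx' : 0 < x') :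
    cosh (dist (UpperHalfPlane.mk ⟨y, x⟩ hx) (UpperHalfPlane.mk ⟨y', x'⟩ hx') / 2) ^ 2 =
      ((y - y') ^ 2 + (x + x') ^ 2) / (4 * x * x') := by
  rw [UpperHalfPlane.cosh_half_dist, div_pow, mul_pow, Complex.dist_eq, ← Complex.normSq_eq_norm_sq,
    sq_sqrt (by positivity), Complex.normSq_apply]
  simp
  ring

theorem hyperbolicHeatIntegrand_dist {t x x' : ℝ} (y y' s : ℝ) (hx : 0 < x) (hx' : 0 < x') :
    hyperbolicHeatIntegrand t
      (dist (UpperHalfPlane.mk ⟨y, x⟩ hx) (UpperHalfPlane.mk ⟨y', x'⟩ hx')) s =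
      horocyclicIntegrand t x x' (y - y') s := by
  rw [hyperbolicHeatIntegrand, horocyclicIntegrand, cosh_half_dist_sq]
  have h : horocyclicSq x x' s - (y - y') ^ 2 = (4 * (x * x')) *
      (cosh (s / 2) ^ 2 - ((y - y') ^ 2 + (x + x') ^ 2) / (4 * x * x')) := by
    rw [horocyclicSq]
    field_simp
    ring
  have h2 : √(4 * (x * x')) = 2 * √(x * x') := by
    rw [sqrt_mul (by norm_num), show (4 : ℝ) = 2 ^ 2 by norm_num, sqrt_sq (by norm_num)]
  have h3 : 0 < √(x * x') := sqrt_pos.2 (by positivity)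
  rw [h, sqrt_mul (show 0 ≤ 4 * (x * x') by positivity), h2, one_div, mul_inv,
    div_eq_mul_inv, mul_inv]
  field_simp

/-- For `s` up to the distance the root has a nonpositive argument, hence equals `0`, and so does
its reciprocal. Extending the integral to `(0, ∞)` adds nothing and makes the domain independent of
`y`, as Fubini requires. -/
theorem hyperbolicHeatKernel_eq {t x x' : ℝ} (y y' : ℝ) (hx : 0 < x) (hx' : 0 < x') :
    hyperbolicHeatKernel t (UpperHalfPlane.mk ⟨y, x⟩ hx) (UpperHalfPlane.mk ⟨y', x'⟩ hx') =
      ∫ s in Ioi 0, horocyclicIntegrand t x x' (y - y') s := by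
  rw [hyperbolicHeatKernel]
  simp_rw [hyperbolicHeatIntegrand_dist y y' _ hx hx']
  refine (setIntegral_eq_of_subset_of_forall_sdiff_eq_zero measurableSet_Ioi
    (Ioi_subset_Ioi dist_nonneg) fun s hs => ?_).symm
  have hs0 : 0 < s := hs.1
  have hs1 : s ≤ _ := not_lt.1 hs.2
  have h := cosh_half_dist_sq y y' hx hx'
  have h1 : cosh (s / 2) ^ 2 ≤ ((y - y') ^ 2 + (x + x') ^ 2) / (4 * x * x') := by
    rw [← h]
    have := cosh_pos (s / 2)
    gcongr
    rw [cosh_le_cosh, abs_of_nonneg (by positivity), abs_of_nonneg (by positivity)]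
    linarith
  rw [le_div_iff₀ (by positivity)] at h1
  have h2 : horocyclicSq x x' s - (y - y') ^ 2 ≤ 0 := by
    rw [horocyclicSq]
    linarith
  rw [horocyclicIntegrand, sqrt_eq_zero_of_nonpos h2]
  simp

theorem measurable_horocyclicIntegrand (t x x' : ℝ) :
    Measurable fun p : ℝ × ℝ => horocyclicIntegrand t x x' p.1 p.2 := by
  unfold horocyclicIntegrand horocyclicSq
  fun_prop

/-- Outside the interval the root is `0` and division by it gives `0`. The case `m ≤ 0` is included,
with an empty interval. -/
theorem div_sqrt_sub_sq_eq_indicator {m : ℝ} (f : ℝ → ℂ) (y : ℝ) :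
    f y / (√(m - y ^ 2) : ℝ) =
      (Ioo (-√m) (√m)).indicator (fun y => f y / (√(√m ^ 2 - y ^ 2) : ℝ)) y := by
  by_cases hy : y ∈ Ioo (-√m) (√m)
  · have hm : 0 < √m := by linarith [hy.1, hy.2]
    rw [indicator_of_mem hy, sq_sqrt (sqrt_pos.1 hm).le]
  · rw [indicator_of_notMem hy, sqrt_eq_zero_of_nonpos]
    · simp
    · by_contra! h
      exact hy (abs_lt.1 ((lt_sqrt (abs_nonneg y)).2 (by rw [sq_abs]; linarith)))

theorem integrable_div_sqrt_sub_sq (m : ℝ) {f : ℝ → ℂ} (hf : Continuous f) :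
    Integrable fun y => f y / (√(m - y ^ 2) : ℝ) := by
  rw [funext (div_sqrt_sub_sq_eq_indicator f)]
  rw [integrable_indicator_iff measurableSet_Ioo]
  rcases lt_or_ge 0 m with hm | hm
  · exact integrableOn_div_sqrt_sq_sub_sq (sqrt_pos.2 hm) hf
  · simp [sqrt_eq_zero_of_nonpos hm]

theorem integral_div_sqrt_sub_sq (m : ℝ) (f : ℝ → ℂ) :
    ∫ y, f y / (√(m - y ^ 2) : ℝ) = ∫ y in Ioo (-√m) (√m), f y / (√(√m ^ 2 - y ^ 2) : ℝ) := by
  rw [funext (div_sqrt_sub_sq_eq_indicator f)]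
  rw [integral_indicator measurableSet_Ioo]

/-- Equality holds for `m > 0`; for `m ≤ 0` the integrand is identically `0` by convention. -/
theorem integral_one_div_sqrt_sub_sq_le (m : ℝ) : ∫ y, 1 / √(m - y ^ 2) ≤ π := by
  rcases lt_or_ge 0 m with hm | hm
  · refine le_of_eq ?_
    have h := integral_div_sqrt_sub_sq m fun _ => 1
    apply Complex.ofReal_injective
    rw [← integral_complex_ofReal]
    rw [← integral_one_div_sqrt_sq_sub_sq (sqrt_pos.2 hm), ← integral_complex_ofReal]
    simpa using h
  · have : ∀ y : ℝ, 1 / √(m - y ^ 2) = 0 := fun y => by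
      rw [sqrt_eq_zero_of_nonpos (by nlinarith [sq_nonneg y])]
      simp
    simp [this, pi_pos.le]

theorem integrable_one_div_sqrt_sub_sq (m : ℝ) : Integrable fun y => 1 / √(m - y ^ 2) := by
  have h := (integrable_div_sqrt_sub_sq m (continuous_const (y := (1 : ℂ)))).norm
  refine h.congr (Filter.Eventually.of_forall fun y => ?_)
  simp [abs_of_nonneg (sqrt_nonneg _)]

/-- Integrating first in `y` costs at most the factor `π`, uniformly in `s`, and leaves the
integrable weight `s e^{-s²/4t}`. -/
theorem integrable_horocyclicIntegrand {t : ℝ} (ht : 0 < t) (x x' : ℝ) :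
    Integrable (fun p : ℝ × ℝ => horocyclicIntegrand t x x' p.1 p.2)
      (volume.prod (volume.restrict (Ioi 0))) := by
  rw [integrable_prod_iff' (measurable_horocyclicIntegrand t x x').aestronglyMeasurable]
  have h : ∀ s, Integrable fun y => horocyclicIntegrand t x x' y s := fun s =>
    (integrable_one_div_sqrt_sub_sq _).const_mul _
  refine ⟨Filter.Eventually.of_forall h, ?_⟩
  set c := 2 * √(x * x') / (4 * π * t) ^ (3 / 2 : ℝ) with hc
  have hc0 : 0 ≤ c := by positivity
  refine (((integrable_mul_exp_neg_sq_div ht).integrableOn (s := Ioi 0)).const_mul (c * π)).mono'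
    ?_ ((ae_restrict_iff' measurableSet_Ioi).2 (Filter.Eventually.of_forall fun s hs => ?_))
  · exact ((measurable_horocyclicIntegrand t x x').norm.comp
      measurable_swap).stronglyMeasurable.integral_prod_right'.aestronglyMeasurable
  · have hs0 : 0 < s := hs
    have h1 : ∀ y, ‖horocyclicIntegrand t x x' y s‖ =
        (c * (s * exp (-s ^ 2 / (4 * t)))) * (1 / √(horocyclicSq x x' s - y ^ 2)) := fun y => by
      rw [horocyclicIntegrand, Real.norm_of_nonneg (by positivity)]
    simp_rw [h1]
    rw [integral_const_mul, Real.norm_of_nonneg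
      (mul_nonneg (by positivity) (integral_nonneg fun y => by positivity))]
    calc _ ≤ (c * (s * exp (-s ^ 2 / (4 * t)))) * π := by
          gcongr
          exact integral_one_div_sqrt_sub_sq_le _
      _ = _ := by ring

theorem integrable_hyperbolicHeatKernel {t x x' : ℝ} (ht : 0 < t) (y' : ℝ) (hx : 0 < x)
    (hx' : 0 < x') :
    Integrable fun y : ℝ =>
      hyperbolicHeatKernel t (UpperHalfPlane.mk ⟨y, x⟩ hx) (UpperHalfPlane.mk ⟨y', x'⟩ hx') := by
  simp_rw [hyperbolicHeatKernel_eq _ y' hx hx']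
  exact ((integrable_horocyclicIntegrand ht x x').integral_prod_left).comp_sub_right y'

theorem integral_cexp_mul_one_div_sqrt {m : ℝ} (hm : 0 < m) (a : ℝ) :
    ∫ y : ℝ, Complex.exp (-Complex.I * a * y) / (√(m - y ^ 2) : ℝ) =
      π * besselJ0 (|a| * √m) := by
  rw [integral_div_sqrt_sub_sq m fun y => Complex.exp (-Complex.I * a * y),
    integral_cexp_div_sqrt (sqrt_pos.2 hm), besselJ0_eq, besselJ0_eq (|a| * _), mul_pow, mul_pow,
    sq_abs]

theorem heatBesselRange_subset {x x' : ℝ} (hx : 0 < x) (hx' : 0 < x') :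
    heatBesselRange x x' = {s | 0 ≤ s ∧ 0 ≤ horocyclicSq x x' s} := by
  ext s
  simp only [heatBesselRange, horocyclicSq, mem_ofPred_eq, div_le_iff₀ (show 0 < 4 * x * x' by
    positivity), sub_nonneg, mul_comm (4 * x * x')]

/-- Strict monotonicity of `cosh` on `s > 0` leaves at most one zero. It has to be discarded because
there the `y`-integral is `0` by convention while `J₀(0) = 1`. -/
theorem horocyclicSq_zeros_null {x x' : ℝ} (hx : 0 < x) (hx' : 0 < x') :
    volume {s : ℝ | 0 < s ∧ horocyclicSq x x' s = 0} = 0 := by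
  refine Set.Subsingleton.measure_zero (fun s hs r hr => ?_) _
  obtain ⟨hs, hs'⟩ := hs
  obtain ⟨hr, hr'⟩ := hr
  have h1 : 4 * x * x' * cosh (s / 2) ^ 2 = 4 * x * x' * cosh (r / 2) ^ 2 := by
    rw [horocyclicSq] at hs' hr'
    linarith
  have h2 := mul_left_cancel₀ (by positivity) h1
  have h3 := (sq_eq_sq₀ (cosh_pos _).le (cosh_pos _).le).1 h2
  have h4 := le_antisymm (cosh_le_cosh.1 h3.le) (cosh_le_cosh.1 h3.ge)
  rw [abs_of_pos (by positivity), abs_of_pos (by positivity)] at h4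
  linarith

theorem heatBesselKernel_eq_fourier {t x x' : ℝ} (a : ℝ) (ht : 0 < t) (y' : ℝ) (hx : 0 < x)
    (hx' : 0 < x') :
    (heatBesselKernel a t x x' : ℂ) =
      1 / (√(x * x') : ℂ) *
        ∫ y : ℝ, Complex.exp (-Complex.I * (a : ℂ) * ((y - y' : ℝ) : ℂ)) *
          (hyperbolicHeatKernel t (UpperHalfPlane.mk ⟨y, x⟩ hx)
            (UpperHalfPlane.mk ⟨y', x'⟩ hx') : ℂ) := by
  set c := 2 * √(x * x') / (4 * π * t) ^ (3 / 2 : ℝ) with hc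
  have hsq : 0 < √(x * x') := sqrt_pos.2 (by positivity)
  simp_rw [hyperbolicHeatKernel_eq _ y' hx hx']
  rw [integral_sub_right_eq_self (fun y : ℝ => Complex.exp (-Complex.I * (a : ℂ) * (y : ℂ)) *
    ((∫ s in Ioi 0, horocyclicIntegrand t x x' y s : ℝ) : ℂ)) y']
  have hint : Integrable (fun p : ℝ × ℝ => Complex.exp (-Complex.I * (a : ℂ) * (p.1 : ℂ)) *
      (horocyclicIntegrand t x x' p.1 p.2 : ℂ)) (volume.prod (volume.restrict (Ioi 0))) := by
    refine (integrable_horocyclicIntegrand ht x x').ofReal.bdd_mul (c := 1)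
      (Continuous.aestronglyMeasurable (by fun_prop)) (Filter.Eventually.of_forall fun p => ?_)
    rw [Complex.norm_exp]
    simp
  have h1 : ∀ y : ℝ, Complex.exp (-Complex.I * (a : ℂ) * (y : ℂ)) *
      ((∫ s in Ioi 0, horocyclicIntegrand t x x' y s : ℝ) : ℂ) =
      ∫ s in Ioi 0, Complex.exp (-Complex.I * (a : ℂ) * (y : ℂ)) *
        (horocyclicIntegrand t x x' y s : ℂ) := fun y => by
    rw [integral_const_mul, integral_complex_ofReal]
  simp_rw [h1]
  rw [integral_integral_swap hint]
  have h2 : ∀ᵐ s ∂volume.restrict (Ioi (0 : ℝ)),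
      (∫ y : ℝ, Complex.exp (-Complex.I * (a : ℂ) * (y : ℂ)) *
        (horocyclicIntegrand t x x' y s : ℂ)) =
      ((c * π * (heatBesselRange x x').indicator (heatBesselIntegrand a t x x') s : ℝ) : ℂ) := by
    have hnull : ∀ᵐ s : ℝ, s ∉ {s : ℝ | 0 < s ∧ horocyclicSq x x' s = 0} :=
      measure_eq_zero_iff_ae_notMem.1 (horocyclicSq_zeros_null hx hx')
    refine (ae_restrict_iff' measurableSet_Ioi).2 ?_
    filter_upwards [hnull] with s hs hs0
    have hs0' : 0 < s := hs0
    have h3 : ∀ y : ℝ, Complex.exp (-Complex.I * (a : ℂ) * (y : ℂ)) *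
        (horocyclicIntegrand t x x' y s : ℂ) =
        ((c * (s * exp (-s ^ 2 / (4 * t))) : ℝ) : ℂ) *
        (Complex.exp (-Complex.I * a * y) / (√(horocyclicSq x x' s - y ^ 2) : ℝ)) := fun y => by
      rw [horocyclicIntegrand, ← hc]
      push_cast
      ring
    simp_rw [h3]
    rw [integral_const_mul]
    rcases lt_trichotomy (horocyclicSq x x' s) 0 with hm | hm | hm
    · rw [indicator_of_notMem (by
        rw [heatBesselRange_subset hx hx']
        exact fun h => absurd h.2 (not_le.2 hm))]
      have : ∀ y : ℝ, √(horocyclicSq x x' s - y ^ 2) = 0 := fun y =>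
        sqrt_eq_zero_of_nonpos (by nlinarith [sq_nonneg y])
      simp [this]
    · exact absurd ⟨hs0', hm⟩ hs
    · rw [indicator_of_mem (by
        rw [heatBesselRange_subset hx hx']
        exact ⟨hs0'.le, hm.le⟩), integral_cexp_mul_one_div_sqrt hm, heatBesselIntegrand,
        ← horocyclicSq]
      push_cast
      ring
  rw [integral_congr_ae h2, integral_complex_ofReal, integral_const_mul,
    setIntegral_indicator (measurableSet_heatBesselRange x x'), heatBesselKernel]
  -- The two domains differ at most by the point `s = 0`, where the factor `s` vanishes.
  have h4 : ∫ s in Ioi 0 ∩ heatBesselRange x x', heatBesselIntegrand a t x x' s =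
      ∫ s in heatBesselRange x x', heatBesselIntegrand a t x x' s := by
    refine (setIntegral_eq_of_subset_of_forall_sdiff_eq_zero (measurableSet_heatBesselRange x x')
      inter_subset_right fun s hs => ?_).symm
    have : s = 0 := le_antisymm (not_lt.1 fun h => hs.2 ⟨h, hs.1⟩) hs.1.1
    simp [heatBesselIntegrand, this]
  rw [h4]
  -- The constants match because `2π / (8 π^{3/2}) = 1 / (4 √π)`.
  have h5 : (4 * π * t) ^ (3 / 2 : ℝ) = 8 * (π * √π) * t ^ (3 / 2 : ℝ) := by
    have h6 : (4 * π : ℝ) ^ (3 / 2 : ℝ) = 8 * (π * √π) := by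
      rw [show (3 / 2 : ℝ) = 1 + 1 / 2 by norm_num, rpow_add (by positivity), rpow_one,
        ← sqrt_eq_rpow, sqrt_mul (by norm_num), show (4 : ℝ) = 2 ^ 2 by norm_num,
        sqrt_sq (by norm_num)]
      ring
    rw [mul_rpow (by positivity) ht.le, h6]
  have hp : 0 < √π := sqrt_pos.2 pi_pos
  have ht' : 0 < t ^ (3 / 2 : ℝ) := by positivity
  have hpi := pi_pos
  rw [← Complex.ofReal_one, ← Complex.ofReal_div, ← Complex.ofReal_mul, Complex.ofReal_inj, hc, h5]
  field_simp
  ring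

end

/-! ### Leibniz's rule and integrals over the characteristic cone. -/

noncomputable section

open MeasureTheory Set Real Filter Topology

/-- A function of two real variables with continuous partial derivatives is strictly
differentiable. -/
theorem hasStrictFDerivAt_of_partial {E : Type*} [NormedAddCommGroup E] [NormedSpace ℝ E]
    {f f₁ f₂ : ℝ → ℝ → E} {u : ℝ × ℝ}
    (h₁ : ∀ᶠ v in 𝓝 u, HasDerivAt (fun p => f p v.2) (f₁ v.1 v.2) v.1)
    (h₂ : ∀ᶠ v in 𝓝 u, HasDerivAt (f v.1) (f₂ v.1 v.2) v.2)
    (c₁ : ContinuousAt (fun v : ℝ × ℝ => f₁ v.1 v.2) u)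
    (c₂ : ContinuousAt (fun v : ℝ × ℝ => f₂ v.1 v.2) u) :
    HasStrictFDerivAt (fun v : ℝ × ℝ => f v.1 v.2)
      ((ContinuousLinearMap.toSpanSingleton ℝ (f₁ u.1 u.2)).coprod
        (ContinuousLinearMap.toSpanSingleton ℝ (f₂ u.1 u.2))) u := by
  have hc : Continuous fun e : E => ContinuousLinearMap.toSpanSingleton ℝ e :=
    (ContinuousLinearMap.toSpanSingletonCLE (𝕜 := ℝ) (E := E)).continuous
  exact hasStrictFDerivAt_uncurry_coprod
    (f₁ := fun p q => ContinuousLinearMap.toSpanSingleton ℝ (f₁ p q))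
    (f₂ := fun p q => ContinuousLinearMap.toSpanSingleton ℝ (f₂ p q))
    (h₁.mono fun v hv => hv.hasFDerivAt) (h₂.mono fun v hv => hv.hasFDerivAt)
    (hc.continuousAt.comp c₁) (hc.continuousAt.comp c₂)

theorem hasDerivAt_comp_of_partial {E : Type*} [NormedAddCommGroup E] [NormedSpace ℝ E]
    {f f₁ f₂ : ℝ → ℝ → E} (h₁ : ∀ p q, HasDerivAt (fun p => f p q) (f₁ p q) p)
    (h₂ : ∀ p q, HasDerivAt (f p) (f₂ p q) q)
    (c₁ : Continuous fun v : ℝ × ℝ => f₁ v.1 v.2) (c₂ : Continuous fun v : ℝ × ℝ => f₂ v.1 v.2)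
    {β : ℝ → ℝ} {β' p : ℝ} (hβ : HasDerivAt β β' p) :
    HasDerivAt (fun p => f p (β p)) (f₁ p (β p) + β' • f₂ p (β p)) p := by
  have h := (hasStrictFDerivAt_of_partial (u := (p, β p)) (Eventually.of_forall fun v => h₁ v.1 v.2)
    (Eventually.of_forall fun v => h₂ v.1 v.2) c₁.continuousAt c₂.continuousAt).hasFDerivAt
  have h' := h.comp_hasDerivAt p ((hasDerivAt_id p).prodMk hβ)
  simpa [Function.comp_def] using h'

theorem hasDerivAt_integral_of_continuous {E : Type*} [NormedAddCommGroup E] [NormedSpace ℝ E]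
    {f f' : ℝ → ℝ → E}
    (cf : Continuous fun v : ℝ × ℝ => f v.1 v.2) (cf' : Continuous fun v : ℝ × ℝ => f' v.1 v.2)
    (hd : ∀ p y, HasDerivAt (fun p => f p y) (f' p y) p) (a b p : ℝ) :
    HasDerivAt (fun p => ∫ y in a..b, f p y) (∫ y in a..b, f' p y) p := by
  obtain ⟨C, hC⟩ := ((isCompact_closedBall p 1).prod isCompact_uIcc).exists_bound_of_continuousOn
    (f := fun v : ℝ × ℝ => f' v.1 v.2) (s := Metric.closedBall p 1 ×ˢ uIcc a b) cf'.continuousOn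
  refine (intervalIntegral.hasDerivAt_integral_of_dominated_loc_of_deriv_le (bound := fun _ => C)
    (F := f) (F' := f') (Metric.closedBall_mem_nhds p one_pos) (Eventually.of_forall fun q => ?_)
    ?_ ?_ ?_ intervalIntegrable_const ?_).2
  · exact (cf.comp (by fun_prop : Continuous fun y : ℝ => (q, y))).aestronglyMeasurable
  · exact (cf.comp (by fun_prop : Continuous fun y : ℝ => (p, y))).intervalIntegrable _ _
  · exact (cf'.comp (by fun_prop : Continuous fun y : ℝ => (p, y))).aestronglyMeasurable
  · exact Eventually.of_forall fun y hy q hq => hC (q, y) ⟨hq, uIoc_subset_uIcc hy⟩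
  · exact Eventually.of_forall fun y _ q _ => hd q y

/-- Leibniz's rule with variable limits. -/
theorem hasDerivAt_integral_variable_limits {E : Type*} [NormedAddCommGroup E] [NormedSpace ℝ E]
    [CompleteSpace E] {f f' : ℝ → ℝ → E}
    (cf : Continuous fun v : ℝ × ℝ => f v.1 v.2) (cf' : Continuous fun v : ℝ × ℝ => f' v.1 v.2)
    (hd : ∀ p y, HasDerivAt (fun p => f p y) (f' p y) p) {α β : ℝ → ℝ} {α' β' p : ℝ}
    (hα : HasDerivAt α α' p) (hβ : HasDerivAt β β' p) :
    HasDerivAt (fun p => ∫ y in α p..β p, f p y)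
      (β' • f p (β p) - α' • f p (α p) + ∫ y in α p..β p, f' p y) p := by
  have hcont : ∀ p, Continuous (f p) := fun p =>
    cf.comp (by fun_prop : Continuous fun y : ℝ => (p, y))
  have hcont' : ∀ p, Continuous (f' p) := fun p =>
    cf'.comp (by fun_prop : Continuous fun y : ℝ => (p, y))
  -- Each limit is treated separately, from the base point 0: the integral is a function of the
  -- parameter and of an independent upper limit, restricted to a curve.
  have key : ∀ {γ : ℝ → ℝ} {γ' : ℝ}, HasDerivAt γ γ' p →
      HasDerivAt (fun p => ∫ y in (0 : ℝ)..γ p, f p y)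
        ((∫ y in (0 : ℝ)..γ p, f' p y) + γ' • f p (γ p)) p := fun hγ =>
    hasDerivAt_comp_of_partial (f := fun p q => ∫ y in (0 : ℝ)..q, f p y)
      (f₁ := fun p q => ∫ y in (0 : ℝ)..q, f' p y) (f₂ := f)
      (fun p q => hasDerivAt_integral_of_continuous cf cf' hd 0 q p)
      (fun p q => intervalIntegral.integral_hasDerivAt_right ((hcont p).intervalIntegrable _ _)
        ((hcont p).stronglyMeasurableAtFilter _ _) (hcont p).continuousAt)
      (intervalIntegral.continuous_parametric_intervalIntegral_of_continuous
        (f := fun (v : ℝ × ℝ) y => f' v.1 y)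
        (cf'.comp (by fun_prop : Continuous fun w : (ℝ × ℝ) × ℝ => (w.1.1, w.2))) continuous_snd)
      cf hγ
  have hsub : ∀ (F : ℝ → E), Continuous F → ∀ u v : ℝ,
      ∫ y in u..v, F y = (∫ y in (0 : ℝ)..v, F y) - ∫ y in (0 : ℝ)..u, F y := fun F hF u v =>
    (intervalIntegral.integral_interval_sub_left (hF.intervalIntegrable _ _)
      (hF.intervalIntegrable _ _)).symm
  have h := (key hβ).sub (key hα)
  have h1 : (fun p => ∫ y in α p..β p, f p y) =
      fun p => (∫ y in (0 : ℝ)..β p, f p y) - ∫ y in (0 : ℝ)..α p, f p y :=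
    funext fun p => hsub _ (hcont p) _ _
  rw [h1, hsub _ (hcont' p)]
  refine h.congr_deriv ?_
  abel

/-- `½ ∫_{x e⁻ˢ}^{x eˢ} k(s, x, y) V(y) dy`. -/
def waveIntegral (V : ℝ → ℂ) (k : ℝ → ℝ → ℝ → ℝ) (s x : ℝ) : ℂ :=
  1 / 2 * ∫ y in x * exp (-s)..x * exp s, (k s x y : ℂ) * V y

theorem continuous_waveIntegral {V : ℝ → ℂ} (hV : Continuous V) {k : ℝ → ℝ → ℝ → ℝ}
    (hk : Continuous fun p : ℝ × ℝ × ℝ => k p.1 p.2.1 p.2.2) :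
    Continuous fun p : ℝ × ℝ => waveIntegral V k p.1 p.2 := by
  have hF : Continuous (fun w : (ℝ × ℝ) × ℝ => ((k w.1.1 w.1.2 w.2 : ℝ) : ℂ) * V w.2) :=
    (Complex.continuous_ofReal.comp
      (hk.comp (by fun_prop : Continuous fun w : (ℝ × ℝ) × ℝ => (w.1.1, w.1.2, w.2)))).mul
      (hV.comp continuous_snd)
  have hF1 : ∀ v : ℝ × ℝ, Continuous fun y => ((k v.1 v.2 y : ℝ) : ℂ) * V y := fun v =>
    hF.comp (by fun_prop : Continuous fun y : ℝ => (v, y))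
  have h : (fun p : ℝ × ℝ => waveIntegral V k p.1 p.2) = fun p : ℝ × ℝ =>
      1 / 2 * ((∫ y in (0 : ℝ)..p.2 * exp p.1, (k p.1 p.2 y : ℂ) * V y) -
        ∫ y in (0 : ℝ)..p.2 * exp (-p.1), (k p.1 p.2 y : ℂ) * V y) := by
    funext p
    rw [waveIntegral, intervalIntegral.integral_interval_sub_left
      ((hF1 p).intervalIntegrable _ _) ((hF1 p).intervalIntegrable _ _)]
  rw [h]
  refine continuous_const.mul (Continuous.sub ?_ ?_)
  · exact intervalIntegral.continuous_parametric_intervalIntegral_of_continuous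
      (f := fun (p : ℝ × ℝ) y => ((k p.1 p.2 y : ℝ) : ℂ) * V y) hF (by fun_prop)
  · exact intervalIntegral.continuous_parametric_intervalIntegral_of_continuous
      (f := fun (p : ℝ × ℝ) y => ((k p.1 p.2 y : ℝ) : ℂ) * V y) hF (by fun_prop)

/-- Oriented integrals of globally continuous functions make the rule valid without sign conditions
on `s` or `x`. The two boundary terms are the contributions of the characteristics `y = x e^{±s}`.
-/
theorem hasDerivAt_waveIntegral_right {V : ℝ → ℂ} (hV : Continuous V) {k k' : ℝ → ℝ → ℝ → ℝ}
    (hk : Continuous fun p : ℝ × ℝ × ℝ => k p.1 p.2.1 p.2.2)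
    (hk' : Continuous fun p : ℝ × ℝ × ℝ => k' p.1 p.2.1 p.2.2)
    (hd : ∀ s x y, HasDerivAt (fun x => k s x y) (k' s x y) x) (s x : ℝ) :
    HasDerivAt (waveIntegral V k s)
      (1 / 2 * (exp s * (k s x (x * exp s) * V (x * exp s)) -
        exp (-s) * (k s x (x * exp (-s)) * V (x * exp (-s)))) + waveIntegral V k' s x) x := by
  have hc : ∀ {k : ℝ → ℝ → ℝ → ℝ}, (Continuous fun p : ℝ × ℝ × ℝ => k p.1 p.2.1 p.2.2) →
      Continuous fun v : ℝ × ℝ => ((k s v.1 v.2 : ℝ) : ℂ) * V v.2 := fun hk =>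
    (Complex.continuous_ofReal.comp
      (hk.comp (by fun_prop : Continuous fun v : ℝ × ℝ => (s, v.1, v.2)))).mul
      (hV.comp continuous_snd)
  have h := hasDerivAt_integral_variable_limits (hc hk) (hc hk')
    (fun p y => (hd s p y).ofReal_comp.mul_const (V y))
    (((hasDerivAt_id x).mul_const (exp (-s))) : HasDerivAt (fun x => x * exp (-s)) _ x)
    (((hasDerivAt_id x).mul_const (exp s)) : HasDerivAt (fun x => x * exp s) _ x)
  refine (h.const_mul (1 / 2 : ℂ)).congr_deriv ?_
  simp only [waveIntegral, one_mul, Complex.real_smul, id]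
  ring

theorem hasDerivAt_waveIntegral_left {V : ℝ → ℂ} (hV : Continuous V) {k k' : ℝ → ℝ → ℝ → ℝ}
    (hk : Continuous fun p : ℝ × ℝ × ℝ => k p.1 p.2.1 p.2.2)
    (hk' : Continuous fun p : ℝ × ℝ × ℝ => k' p.1 p.2.1 p.2.2)
    (hd : ∀ s x y, HasDerivAt (fun s => k s x y) (k' s x y) s) (s x : ℝ) :
    HasDerivAt (fun s => waveIntegral V k s x)
      (1 / 2 * (x * exp s * (k s x (x * exp s) * V (x * exp s)) +
        x * exp (-s) * (k s x (x * exp (-s)) * V (x * exp (-s)))) + waveIntegral V k' s x) s := by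
  have hc : ∀ {k : ℝ → ℝ → ℝ → ℝ}, (Continuous fun p : ℝ × ℝ × ℝ => k p.1 p.2.1 p.2.2) →
      Continuous fun v : ℝ × ℝ => ((k v.1 x v.2 : ℝ) : ℂ) * V v.2 := fun hk =>
    (Complex.continuous_ofReal.comp
      (hk.comp (by fun_prop : Continuous fun v : ℝ × ℝ => (v.1, x, v.2)))).mul
      (hV.comp continuous_snd)
  have h := hasDerivAt_integral_variable_limits (hc hk) (hc hk')
    (fun p y => (hd p x y).ofReal_comp.mul_const (V y))
    (((hasDerivAt_neg s).exp.const_mul x) : HasDerivAt (fun s => x * exp (-s)) _ s)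
    (((hasDerivAt_id s).exp.const_mul x) : HasDerivAt (fun s => x * exp s) _ s)
  refine (h.const_mul (1 / 2 : ℂ)).congr_deriv ?_
  simp only [waveIntegral, Complex.real_smul, id]
  push_cast
  ring

end

/-! ### Exponential growth classes and the Riemann function. -/

noncomputable section

open MeasureTheory Set Real Filter Topology

/-- `f` is bounded on `S` by a constant times an exponential of a multiple of `e`. -/
def HasExpBound {ι E : Type*} [Norm E] (S : Set ι) (e : ι → ℝ) (f : ι → E) : Prop :=
  ∃ C m : ℝ, 0 ≤ C ∧ 0 ≤ m ∧ ∀ i ∈ S, ‖f i‖ ≤ C * exp (m * e i)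

namespace HasExpBound

variable {ι E : Type*} {S : Set ι} {e : ι → ℝ}

theorem of_bounded [Norm E] {f : ι → E} (C : ℝ) (hC : 0 ≤ C) (h : ∀ i ∈ S, ‖f i‖ ≤ C) :
    HasExpBound S e f :=
  ⟨C, 0, hC, le_rfl, fun i hi => by simpa using h i hi⟩

theorem mono [Norm E] {F : Type*} [Norm F] {f : ι → E} {g : ι → F} (hg : HasExpBound S e g)
    (h : ∀ i ∈ S, ‖f i‖ ≤ ‖g i‖) : HasExpBound S e f := by
  obtain ⟨C, m, hC, hm, hb⟩ := hg
  exact ⟨C, m, hC, hm, fun i hi => (h i hi).trans (hb i hi)⟩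

theorem const [NormedAddCommGroup E] (c : E) : HasExpBound S e fun _ => c :=
  of_bounded ‖c‖ (norm_nonneg c) fun _ _ => le_rfl

theorem add [NormedAddCommGroup E] (he : ∀ i ∈ S, 0 ≤ e i) {f g : ι → E}
    (hf : HasExpBound S e f) (hg : HasExpBound S e g) :
    HasExpBound S e fun i => f i + g i := by
  obtain ⟨C, m, hC, hm, hb⟩ := hf
  obtain ⟨C', m', hC', hm', hb'⟩ := hg
  refine ⟨C + C', max m m', by positivity, by positivity, fun i hi => ?_⟩
  have h := he i hi
  calc ‖f i + g i‖ ≤ C * exp (m * e i) + C' * exp (m' * e i) :=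
        (norm_add_le _ _).trans (add_le_add (hb i hi) (hb' i hi))
    _ ≤ C * exp (max m m' * e i) + C' * exp (max m m' * e i) := by
        gcongr
        · exact le_max_left _ _
        · exact le_max_right _ _
    _ = _ := by ring

theorem mul [NormedRing E] {f g : ι → E} (hf : HasExpBound S e f) (hg : HasExpBound S e g) :
    HasExpBound S e fun i => f i * g i := by
  obtain ⟨C, m, hC, hm, hb⟩ := hf
  obtain ⟨C', m', hC', hm', hb'⟩ := hg
  refine ⟨C * C', m + m', by positivity, by positivity, fun i hi => ?_⟩
  calc ‖f i * g i‖ ≤ C * exp (m * e i) * (C' * exp (m' * e i)) :=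
        (norm_mul_le _ _).trans (mul_le_mul (hb i hi) (hb' i hi) (norm_nonneg _) (by positivity))
    _ = _ := by
        rw [add_mul, exp_add]
        ring

theorem neg [NormedAddCommGroup E] {f : ι → E} (hf : HasExpBound S e f) :
    HasExpBound S e fun i => -f i :=
  hf.mono fun _ _ => (norm_neg _).le

theorem sub [NormedAddCommGroup E] (he : ∀ i ∈ S, 0 ≤ e i) {f g : ι → E}
    (hf : HasExpBound S e f) (hg : HasExpBound S e g) :
    HasExpBound S e fun i => f i - g i := by
  simpa only [sub_eq_add_neg] using hf.add he hg.neg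

theorem ofReal {f : ι → ℝ} (hf : HasExpBound S e f) : HasExpBound S e fun i => (f i : ℂ) :=
  hf.mono fun i _ => by simp

theorem exp_self : HasExpBound S e fun i => exp (e i) :=
  ⟨1, 1, by simp, by simp, fun _ _ => by simp⟩

theorem exp_neg (he : ∀ i ∈ S, 0 ≤ e i) : HasExpBound S e fun i => exp (-e i) :=
  of_bounded 1 zero_le_one fun i hi => by simpa using he i hi

theorem cosh_self (he : ∀ i ∈ S, 0 ≤ e i) : HasExpBound S e fun i => cosh (e i) := by
  simp_rw [cosh_eq, div_eq_mul_inv]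
  exact (exp_self.add he (exp_neg he)).mul (const _)

theorem sinh_self (he : ∀ i ∈ S, 0 ≤ e i) : HasExpBound S e fun i => sinh (e i) := by
  simp_rw [sinh_eq, div_eq_mul_inv]
  exact (exp_self.sub he (exp_neg he)).mul (const _)

end HasExpBound

/-- The region `s ≥ 0`, `0 < x ≤ X`. -/
def waveRegion (X : ℝ) : Set (ℝ × ℝ) := {p | 0 ≤ p.1 ∧ 0 < p.2 ∧ p.2 ≤ X}

/-- The domain of dependence `x e⁻ˢ ≤ y ≤ x eˢ` over `waveRegion X`. -/
def waveCone (X : ℝ) : Set (ℝ × ℝ × ℝ) :=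
  {p | 0 ≤ p.1 ∧ 0 < p.2.1 ∧ p.2.1 ≤ X ∧ p.2.1 * exp (-p.1) ≤ p.2.2 ∧ p.2.2 ≤ p.2.1 * exp p.1}

/-- Locally uniform exponential growth in the first variable. -/
def HasWaveGrowth (f : ℝ → ℝ → ℂ) : Prop :=
  ∀ X : ℝ, 0 < X → HasExpBound (waveRegion X) Prod.fst fun p => f p.1 p.2

/-- The slice of the cone has length at most `X eˢ`, so integration raises the exponential rate by
one. -/
theorem hasWaveGrowth_waveIntegral {V : ℝ → ℂ} {B : ℝ} (hB : ∀ y, ‖V y‖ ≤ B)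
    {k : ℝ → ℝ → ℝ → ℝ}
    (hk : ∀ X : ℝ, 0 < X → HasExpBound (waveCone X) Prod.fst fun p => k p.1 p.2.1 p.2.2) :
    HasWaveGrowth (waveIntegral V k) := by
  intro X hX
  obtain ⟨C, m, hC, hm, hb⟩ := hk X hX
  have hB0 : 0 ≤ B := (norm_nonneg _).trans (hB 0)
  refine ⟨C * B * X, m + 1, by positivity, by positivity, fun p hp => ?_⟩
  obtain ⟨hs, hx, hxX⟩ := hp
  have hle : p.2 * exp (-p.1) ≤ p.2 * exp p.1 := by
    gcongr
    linarith
  have h1 : ‖∫ y in p.2 * exp (-p.1)..p.2 * exp p.1, (k p.1 p.2 y : ℂ) * V y‖ ≤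
      C * exp (m * p.1) * B * |p.2 * exp p.1 - p.2 * exp (-p.1)| := by
    refine intervalIntegral.norm_integral_le_of_norm_le_const fun y hy => ?_
    rw [uIoc_of_le hle] at hy
    rw [norm_mul, Complex.norm_real]
    exact mul_le_mul (hb (p.1, p.2, y) ⟨hs, hx, hxX, hy.1.le, hy.2⟩) (hB y) (norm_nonneg _)
      (by positivity)
  have h2 : |p.2 * exp p.1 - p.2 * exp (-p.1)| ≤ X * exp p.1 := by
    rw [abs_of_nonneg (by linarith)]
    have h3 : 0 ≤ p.2 * exp (-p.1) := by positivity
    have h4 : p.2 * exp p.1 ≤ X * exp p.1 := by gcongr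
    linarith
  dsimp only
  rw [waveIntegral, norm_mul]
  calc _ ≤ 1 * (C * exp (m * p.1) * B * (X * exp p.1)) := by
        refine mul_le_mul (by norm_num) (h1.trans ?_) (norm_nonneg _) zero_le_one
        gcongr
    _ = _ := by
        rw [add_mul, exp_add, one_mul, one_mul]
        ring

theorem HasExpBound.comp_waveCone_right {X : ℝ} {k : ℝ → ℝ → ℝ → ℝ}
    (hk : HasExpBound (waveCone X) Prod.fst fun p => k p.1 p.2.1 p.2.2) :
    HasExpBound (waveRegion X) Prod.fst fun p => k p.1 p.2 (p.2 * exp p.1) := by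
  obtain ⟨C, m, hC, hm, hb⟩ := hk
  refine ⟨C, m, hC, hm, fun p hp => hb (p.1, p.2, p.2 * exp p.1) ⟨hp.1, hp.2.1, hp.2.2, ?_, le_rfl⟩⟩
  obtain ⟨hs, hx, -⟩ := hp
  dsimp only
  gcongr
  linarith

theorem HasExpBound.comp_waveCone_left {X : ℝ} {k : ℝ → ℝ → ℝ → ℝ}
    (hk : HasExpBound (waveCone X) Prod.fst fun p => k p.1 p.2.1 p.2.2) :
    HasExpBound (waveRegion X) Prod.fst fun p => k p.1 p.2 (p.2 * exp (-p.1)) := by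
  obtain ⟨C, m, hC, hm, hb⟩ := hk
  refine ⟨C, m, hC, hm, fun p hp =>
    hb (p.1, p.2, p.2 * exp (-p.1)) ⟨hp.1, hp.2.1, hp.2.2, le_rfl, ?_⟩⟩
  obtain ⟨hs, hx, -⟩ := hp
  dsimp only
  gcongr
  linarith

/-- The argument of the Bessel–Clifford function in the Riemann function of the wave equation
`∂ₛ² = (x ∂ₓ)² - 4 b x²`. -/
def besselPhase (b s x y : ℝ) : ℝ := b * (2 * x * y * cosh s - x ^ 2 - y ^ 2)

def riemannKernel (b s x y : ℝ) : ℝ := besselClifford 0 (besselPhase b s x y)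

def riemannKernelX (b s x y : ℝ) : ℝ :=
  -besselClifford 1 (besselPhase b s x y) * (b * (2 * y * cosh s - 2 * x))

def riemannKernelXX (b s x y : ℝ) : ℝ :=
  besselClifford 2 (besselPhase b s x y) * (b * (2 * y * cosh s - 2 * x)) ^ 2 +
    2 * b * besselClifford 1 (besselPhase b s x y)

def riemannKernelS (b s x y : ℝ) : ℝ :=
  -besselClifford 1 (besselPhase b s x y) * (b * (2 * x * y * sinh s))

def riemannKernelSS (b s x y : ℝ) : ℝ :=
  besselClifford 2 (besselPhase b s x y) * (b * (2 * x * y * sinh s)) ^ 2 -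
    besselClifford 1 (besselPhase b s x y) * (b * (2 * x * y * cosh s))

theorem continuous_besselPhase (b : ℝ) :
    Continuous fun p : ℝ × ℝ × ℝ => besselPhase b p.1 p.2.1 p.2.2 := by
  unfold besselPhase
  fun_prop

theorem continuous_besselClifford_phase (j : ℕ) (b : ℝ) :
    Continuous fun p : ℝ × ℝ × ℝ => besselClifford j (besselPhase b p.1 p.2.1 p.2.2) :=
  (continuous_besselClifford j).comp (continuous_besselPhase b)

theorem continuous_riemannKernel (b : ℝ) :
    Continuous fun p : ℝ × ℝ × ℝ => riemannKernel b p.1 p.2.1 p.2.2 :=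
  continuous_besselClifford_phase 0 b

theorem continuous_riemannKernelX (b : ℝ) :
    Continuous fun p : ℝ × ℝ × ℝ => riemannKernelX b p.1 p.2.1 p.2.2 := by
  have := continuous_besselClifford_phase 1 b
  unfold riemannKernelX
  fun_prop

theorem continuous_riemannKernelXX (b : ℝ) :
    Continuous fun p : ℝ × ℝ × ℝ => riemannKernelXX b p.1 p.2.1 p.2.2 := by
  have := continuous_besselClifford_phase 1 b
  have := continuous_besselClifford_phase 2 b
  unfold riemannKernelXX
  fun_prop

theorem continuous_riemannKernelS (b : ℝ) :
    Continuous fun p : ℝ × ℝ × ℝ => riemannKernelS b p.1 p.2.1 p.2.2 := by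
  have := continuous_besselClifford_phase 1 b
  unfold riemannKernelS
  fun_prop

theorem continuous_riemannKernelSS (b : ℝ) :
    Continuous fun p : ℝ × ℝ × ℝ => riemannKernelSS b p.1 p.2.1 p.2.2 := by
  have := continuous_besselClifford_phase 1 b
  have := continuous_besselClifford_phase 2 b
  unfold riemannKernelSS
  fun_prop

theorem hasDerivAt_besselPhase_x (b s x y : ℝ) :
    HasDerivAt (fun x => besselPhase b s x y) (b * (2 * y * cosh s - 2 * x)) x := by
  have h := ((((((hasDerivAt_id x).const_mul 2).mul_const y).mul_const (cosh s)).sub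
    (hasDerivAt_pow 2 x)).sub_const (y ^ 2)).const_mul b
  refine h.congr_deriv ?_
  simp

theorem hasDerivAt_besselPhase_s (b s x y : ℝ) :
    HasDerivAt (fun s => besselPhase b s x y) (b * (2 * x * y * sinh s)) s :=
  ((((hasDerivAt_cosh s).const_mul (2 * x * y)).sub_const (x ^ 2)).sub_const (y ^ 2)).const_mul b

theorem hasDerivAt_riemannKernel_x (b s x y : ℝ) :
    HasDerivAt (fun x => riemannKernel b s x y) (riemannKernelX b s x y) x :=
  (hasDerivAt_besselClifford 0 _).comp x (hasDerivAt_besselPhase_x b s x y)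

theorem hasDerivAt_riemannKernel_s (b s x y : ℝ) :
    HasDerivAt (fun s => riemannKernel b s x y) (riemannKernelS b s x y) s :=
  (hasDerivAt_besselClifford 0 _).comp s (hasDerivAt_besselPhase_s b s x y)

theorem hasDerivAt_riemannKernelX (b s x y : ℝ) :
    HasDerivAt (fun x => riemannKernelX b s x y) (riemannKernelXX b s x y) x := by
  have h1 := ((hasDerivAt_besselClifford 1 _).comp x (hasDerivAt_besselPhase_x b s x y)).neg
  have h2 := (((hasDerivAt_id x).const_mul 2).const_sub (2 * y * cosh s)).const_mul b
  refine (h1.mul h2).congr_deriv ?_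
  simp only [riemannKernelXX, Function.comp, id, Pi.neg_apply]
  ring

theorem hasDerivAt_riemannKernelS (b s x y : ℝ) :
    HasDerivAt (fun s => riemannKernelS b s x y) (riemannKernelSS b s x y) s := by
  have h1 := ((hasDerivAt_besselClifford 1 _).comp s (hasDerivAt_besselPhase_s b s x y)).neg
  have h2 := ((hasDerivAt_sinh s).const_mul (2 * x * y)).const_mul b
  refine (h1.mul h2).congr_deriv ?_
  simp only [riemannKernelSS, Function.comp, Pi.neg_apply]
  ring

/-- The Riemann function solves the wave equation. -/
theorem riemannKernel_wave (b s x y : ℝ) :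
    riemannKernelSS b s x y = x ^ 2 * riemannKernelXX b s x y + x * riemannKernelX b s x y -
      4 * b * x ^ 2 * riemannKernel b s x y := by
  have h := besselClifford_recurrence 0 (besselPhase b s x y)
  have hc := cosh_sq s
  simp only [zero_add, Nat.cast_zero, one_mul] at h
  rw [riemannKernelSS, riemannKernelXX, riemannKernelX, riemannKernel]
  -- Eliminating `φ₀` by the recurrence leaves an identity linear in `φ₁` and `φ₂`, which needs only
  -- `cosh² - sinh² = 1`.
  rw [show besselClifford 0 (besselPhase b s x y) = besselClifford 1 (besselPhase b s x y) -
    besselPhase b s x y * besselClifford 2 (besselPhase b s x y) by linarith]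
  generalize besselClifford 1 (besselPhase b s x y) = u
  generalize besselClifford 2 (besselPhase b s x y) = v
  rw [besselPhase]
  linear_combination (-4 * v * b ^ 2 * x ^ 2 * y ^ 2) * hc

theorem besselPhase_right (b s x : ℝ) : besselPhase b s x (x * exp s) = 0 := by
  rw [besselPhase, cosh_eq, exp_neg]
  have := exp_pos s
  field_simp
  ring

theorem besselPhase_left (b s x : ℝ) : besselPhase b s x (x * exp (-s)) = 0 := by
  rw [besselPhase, cosh_eq, exp_neg]
  have := exp_pos s
  field_simp
  ring

/-- The phase is `b (x eˢ - y)(y - x e⁻ˢ)`: zero on the characteristics and nonnegative between them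
for `b ≥ 0`, which is where the bounds on `φ_j` apply. -/
theorem besselPhase_nonneg {b s x y : ℝ} (hb : 0 ≤ b) (h1 : x * exp (-s) ≤ y)
    (h2 : y ≤ x * exp s) : 0 ≤ besselPhase b s x y := by
  have h3 : exp s * exp (-s) = 1 := by rw [← exp_add]; simp
  have h : besselPhase b s x y = b * ((x * exp s - y) * (y - x * exp (-s))) := by
    rw [besselPhase, cosh_eq]
    linear_combination b * x ^ 2 * h3
  rw [h]
  exact mul_nonneg hb (mul_nonneg (by linarith) (by linarith))

section Growth

variable {X : ℝ}

theorem waveCone_fst_nonneg : ∀ p ∈ waveCone X, 0 ≤ Prod.fst p := fun _ hp => hp.1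

theorem waveRegion_fst_nonneg : ∀ p ∈ waveRegion X, 0 ≤ Prod.fst p := fun _ hp => hp.1

theorem hasExpBound_waveCone_x (hX : 0 < X) :
    HasExpBound (waveCone X) Prod.fst fun p => p.2.1 :=
  .of_bounded X hX.le fun p hp => by
    rw [Real.norm_of_nonneg hp.2.1.le]
    exact hp.2.2.1

theorem hasExpBound_waveRegion_x (hX : 0 < X) :
    HasExpBound (waveRegion X) Prod.fst fun p => p.2 :=
  .of_bounded X hX.le fun p hp => by
    rw [Real.norm_of_nonneg hp.2.1.le]
    exact hp.2.2

theorem hasExpBound_waveCone_y (hX : 0 < X) :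
    HasExpBound (waveCone X) Prod.fst fun p => p.2.2 := by
  refine ((hasExpBound_waveCone_x hX).mul .exp_self).mono fun p hp => ?_
  have hx := hp.2.1
  have hy : 0 ≤ p.2.2 := le_trans (by positivity) hp.2.2.2.1
  rw [Real.norm_of_nonneg hy, Real.norm_of_nonneg (by positivity)]
  exact hp.2.2.2.2

theorem hasExpBound_besselClifford_one {b : ℝ} (hb : 0 ≤ b) :
    HasExpBound (waveCone X) Prod.fst
      fun p => besselClifford 1 (besselPhase b p.1 p.2.1 p.2.2) := by
  obtain ⟨B, hB, h⟩ := exists_abs_besselClifford_le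
  exact .of_bounded B hB fun p hp => (h _ (besselPhase_nonneg hb hp.2.2.2.1 hp.2.2.2.2)).1

theorem hasExpBound_besselClifford_two {b : ℝ} (hb : 0 ≤ b) :
    HasExpBound (waveCone X) Prod.fst
      fun p => besselClifford 2 (besselPhase b p.1 p.2.1 p.2.2) := by
  obtain ⟨B, hB, h⟩ := exists_abs_besselClifford_le
  exact .of_bounded B hB fun p hp => (h _ (besselPhase_nonneg hb hp.2.2.2.1 hp.2.2.2.2)).2

theorem hasExpBound_riemannKernel {b : ℝ} (hb : 0 ≤ b) :
    HasExpBound (waveCone X) Prod.fst fun p => riemannKernel b p.1 p.2.1 p.2.2 :=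
  .of_bounded 1 zero_le_one fun _ hp =>
    abs_besselClifford_zero_le (besselPhase_nonneg hb hp.2.2.2.1 hp.2.2.2.2)

theorem hasExpBound_phaseX (hX : 0 < X) (b : ℝ) :
    HasExpBound (waveCone X) Prod.fst fun p => b * (2 * p.2.2 * cosh p.1 - 2 * p.2.1) :=
  (HasExpBound.const b).mul ((((HasExpBound.const 2).mul (hasExpBound_waveCone_y hX)).mul
    (.cosh_self waveCone_fst_nonneg)).sub waveCone_fst_nonneg
    ((HasExpBound.const 2).mul (hasExpBound_waveCone_x hX)))

theorem hasExpBound_riemannKernelX (hX : 0 < X) {b : ℝ} (hb : 0 ≤ b) :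
    HasExpBound (waveCone X) Prod.fst fun p => riemannKernelX b p.1 p.2.1 p.2.2 :=
  (hasExpBound_besselClifford_one hb).neg.mul (hasExpBound_phaseX hX b)

theorem hasExpBound_riemannKernelXX (hX : 0 < X) {b : ℝ} (hb : 0 ≤ b) :
    HasExpBound (waveCone X) Prod.fst fun p => riemannKernelXX b p.1 p.2.1 p.2.2 := by
  simp_rw [riemannKernelXX, sq]
  exact ((hasExpBound_besselClifford_two hb).mul ((hasExpBound_phaseX hX b).mul
    (hasExpBound_phaseX hX b))).add waveCone_fst_nonneg
    ((HasExpBound.const (2 * b)).mul (hasExpBound_besselClifford_one hb))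

theorem hasExpBound_riemannKernelS (hX : 0 < X) {b : ℝ} (hb : 0 ≤ b) :
    HasExpBound (waveCone X) Prod.fst fun p => riemannKernelS b p.1 p.2.1 p.2.2 :=
  (hasExpBound_besselClifford_one hb).neg.mul ((HasExpBound.const b).mul
    ((((HasExpBound.const 2).mul (hasExpBound_waveCone_x hX)).mul (hasExpBound_waveCone_y hX)).mul
    (.sinh_self waveCone_fst_nonneg)))

end Growth

end

/-! ### The solution of the wave equation by Riemann's method. -/

noncomputable section

open MeasureTheory Set Real Filter Topology

/-- `W` solves the wave equation `∂ₛ² W = L^a W` on `ℝ × (0, ∞)` with `W(0, x) = 0`; its partial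
derivatives are continuous and grow at most exponentially in `s`. -/
structure IsWaveSolution (a : ℝ) (W Wx Wxx Ws Wss : ℝ → ℝ → ℂ) : Prop where
  zero : ∀ x, W 0 x = 0
  deriv_x : ∀ s x, HasDerivAt (W s) (Wx s x) x
  deriv_xx : ∀ s x, HasDerivAt (Wx s) (Wxx s x) x
  deriv_s : ∀ s x, HasDerivAt (fun s => W s x) (Ws s x) s
  deriv_ss : ∀ s x, HasDerivAt (fun s => Ws s x) (Wss s x) s
  cont : Continuous fun p : ℝ × ℝ => W p.1 p.2
  cont_x : Continuous fun p : ℝ × ℝ => Wx p.1 p.2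
  cont_xx : Continuous fun p : ℝ × ℝ => Wxx p.1 p.2
  growth : HasWaveGrowth W
  growth_x : HasWaveGrowth Wx
  growth_xx : HasWaveGrowth Wxx
  growth_s : HasWaveGrowth Ws
  wave : ∀ s x, Wss s x = x ^ 2 * Wxx s x + x * Wx s x - a ^ 2 * x ^ 2 * W s x

theorem IsWaveSolution.growth_ss {a : ℝ} {W Wx Wxx Ws Wss : ℝ → ℝ → ℂ}
    (h : IsWaveSolution a W Wx Wxx Ws Wss) : HasWaveGrowth Wss := by
  intro X hX
  simp_rw [h.wave, sq]
  have hx := (hasExpBound_waveRegion_x hX).ofReal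
  exact (((hx.mul hx).mul (h.growth_xx X hX)).add waveRegion_fst_nonneg
    (hx.mul (h.growth_x X hX))).sub waveRegion_fst_nonneg
    (((HasExpBound.const _).mul (hx.mul hx)).mul (h.growth X hX))

theorem IsWaveSolution.cont_ss {a : ℝ} {W Wx Wxx Ws Wss : ℝ → ℝ → ℂ}
    (h : IsWaveSolution a W Wx Wxx Ws Wss) : Continuous fun p : ℝ × ℝ => Wss p.1 p.2 := by
  simp_rw [h.wave]
  have := h.cont
  have := h.cont_x
  have := h.cont_xx
  fun_prop

def waveW (V : ℝ → ℂ) (b : ℝ) : ℝ → ℝ → ℂ := waveIntegral V (riemannKernel b)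

def waveX (V : ℝ → ℂ) (b s x : ℝ) : ℂ :=
  1 / 2 * (exp s * (riemannKernel b s x (x * exp s) * V (x * exp s)) -
    exp (-s) * (riemannKernel b s x (x * exp (-s)) * V (x * exp (-s)))) +
    waveIntegral V (riemannKernelX b) s x

/-- The first line differentiates the boundary terms of `waveX` after replacing the kernel by its
value 1 on the characteristics, which is why it contains only `deriv V`. The same is done in
`waveSS`. -/
def waveXX (V : ℝ → ℂ) (b s x : ℝ) : ℂ :=
  1 / 2 * (exp s * (exp s * deriv V (x * exp s)) -
    exp (-s) * (exp (-s) * deriv V (x * exp (-s)))) +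
  (1 / 2 * (exp s * (riemannKernelX b s x (x * exp s) * V (x * exp s)) -
    exp (-s) * (riemannKernelX b s x (x * exp (-s)) * V (x * exp (-s)))) +
    waveIntegral V (riemannKernelXX b) s x)

def waveS (V : ℝ → ℂ) (b s x : ℝ) : ℂ :=
  1 / 2 * (x * exp s * (riemannKernel b s x (x * exp s) * V (x * exp s)) +
    x * exp (-s) * (riemannKernel b s x (x * exp (-s)) * V (x * exp (-s)))) +
    waveIntegral V (riemannKernelS b) s x

def waveSS (V : ℝ → ℂ) (b s x : ℝ) : ℂ :=
  1 / 2 * (x * exp s * V (x * exp s) + x * exp s * (x * exp s * deriv V (x * exp s)) -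
    (x * exp (-s) * V (x * exp (-s)) +
      x * exp (-s) * (x * exp (-s) * deriv V (x * exp (-s))))) +
  (1 / 2 * (x * exp s * (riemannKernelS b s x (x * exp s) * V (x * exp s)) +
    x * exp (-s) * (riemannKernelS b s x (x * exp (-s)) * V (x * exp (-s)))) +
    waveIntegral V (riemannKernelSS b) s x)

theorem riemannKernel_right (b s x : ℝ) : riemannKernel b s x (x * exp s) = 1 := by
  rw [riemannKernel, besselPhase_right, besselClifford_zero_zero]

theorem riemannKernel_left (b s x : ℝ) : riemannKernel b s x (x * exp (-s)) = 1 := by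
  rw [riemannKernel, besselPhase_left, besselClifford_zero_zero]

theorem hasDerivAt_comp_mul_const {V : ℝ → ℂ} (hV : ContDiff ℝ 1 V) (c x : ℝ) :
    HasDerivAt (fun x => V (x * c)) (c * deriv V (x * c)) x := by
  have h1 : HasDerivAt V (deriv V (x * c)) (x * c) :=
    (hV.differentiable one_ne_zero _).hasDerivAt
  have h := h1.scomp x ((hasDerivAt_id x).mul_const c)
  simpa [Function.comp_def] using h

theorem hasDerivAt_comp_const_mul_exp {V : ℝ → ℂ} (hV : ContDiff ℝ 1 V) (x s : ℝ) :
    HasDerivAt (fun s => V (x * exp s)) (x * exp s * deriv V (x * exp s)) s := by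
  have h1 : HasDerivAt V (deriv V (x * exp s)) (x * exp s) :=
    (hV.differentiable one_ne_zero _).hasDerivAt
  have h := h1.scomp s ((hasDerivAt_exp s).const_mul x)
  simpa [Function.comp_def] using h

theorem hasDerivAt_comp_const_mul_exp_neg {V : ℝ → ℂ} (hV : ContDiff ℝ 1 V) (x s : ℝ) :
    HasDerivAt (fun s => V (x * exp (-s))) (-(x * exp (-s) * deriv V (x * exp (-s)))) s := by
  have h1 : HasDerivAt V (deriv V (x * exp (-s))) (x * exp (-s)) :=
    (hV.differentiable one_ne_zero _).hasDerivAt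
  have h := h1.scomp s ((hasDerivAt_neg s).exp.const_mul x)
  simpa [Function.comp_def] using h

theorem waveIntegral_riemannKernelSS {V : ℝ → ℂ} (hV : Continuous V) (b s x : ℝ) :
    waveIntegral V (riemannKernelSS b) s x =
      x ^ 2 * waveIntegral V (riemannKernelXX b) s x + x * waveIntegral V (riemannKernelX b) s x -
        4 * b * x ^ 2 * waveIntegral V (riemannKernel b) s x := by
  have hi : ∀ {k : ℝ → ℝ → ℝ → ℝ}, (Continuous fun p : ℝ × ℝ × ℝ => k p.1 p.2.1 p.2.2) →
      IntervalIntegrable (fun y => (k s x y : ℂ) * V y) volume (x * exp (-s)) (x * exp s) :=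
    fun hk => ((Complex.continuous_ofReal.comp
      (hk.comp (by fun_prop : Continuous fun y : ℝ => (s, x, y)))).mul hV).intervalIntegrable _ _
  have h : ∀ y, (riemannKernelSS b s x y : ℂ) * V y =
      x ^ 2 * ((riemannKernelXX b s x y : ℂ) * V y) + x * ((riemannKernelX b s x y : ℂ) * V y) -
        4 * b * x ^ 2 * ((riemannKernel b s x y : ℂ) * V y) := fun y => by
    rw [riemannKernel_wave]
    push_cast
    ring
  simp_rw [waveIntegral, h]
  rw [intervalIntegral.integral_sub (((hi (continuous_riemannKernelXX b)).const_mul _).add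
      ((hi (continuous_riemannKernelX b)).const_mul _))
      ((hi (continuous_riemannKernel b)).const_mul _),
    intervalIntegral.integral_add ((hi (continuous_riemannKernelXX b)).const_mul _)
      ((hi (continuous_riemannKernelX b)).const_mul _)]
  simp_rw [intervalIntegral.integral_const_mul]
  ring

/-- Inside the cone the Riemann function solves the equation. On the characteristics `y = x e^{±s}`
one has `∂ₛ = ± x ∂ₓ` on the phase, so the boundary terms cancel as well. -/
theorem waveSS_eq {V : ℝ → ℂ} (hV : Continuous V) (b s x : ℝ) :
    waveSS V b s x =
      x ^ 2 * waveXX V b s x + x * waveX V b s x - 4 * b * x ^ 2 * waveW V b s x := by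
  have h1 : riemannKernelS b s x (x * exp s) = x * riemannKernelX b s x (x * exp s) := by
    rw [riemannKernelS, riemannKernelX, cosh_eq, sinh_eq, exp_neg]
    have := exp_pos s
    field_simp
    ring
  have h2 : riemannKernelS b s x (x * exp (-s)) = -(x * riemannKernelX b s x (x * exp (-s))) := by
    rw [riemannKernelS, riemannKernelX, cosh_eq, sinh_eq, exp_neg]
    have := exp_pos s
    field_simp
    ring
  rw [waveSS, waveXX, waveX, waveW, waveIntegral_riemannKernelSS hV, h1, h2, riemannKernel_left,
    riemannKernel_right]
  push_cast
  ring

theorem waveW_zero (V : ℝ → ℂ) (b x : ℝ) : waveW V b 0 x = 0 := by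
  simp [waveW, waveIntegral]

theorem hasExpBound_comp {V : ℝ → ℂ} {B : ℝ} (hB : ∀ y, ‖V y‖ ≤ B) {X : ℝ}
    (φ : ℝ × ℝ → ℝ) : HasExpBound (waveRegion X) Prod.fst fun p => V (φ p) :=
  .of_bounded B ((norm_nonneg _).trans (hB 0)) fun _ _ => hB _

theorem hasWaveGrowth_waveX {V : ℝ → ℂ} {B : ℝ} (hB : ∀ y, ‖V y‖ ≤ B) {b : ℝ} (hb : 0 ≤ b) :
    HasWaveGrowth (waveX V b) := by
  intro X hX
  have hexp : HasExpBound (waveRegion X) Prod.fst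
      fun p => ((exp p.1 : ℝ) : ℂ) := HasExpBound.exp_self.ofReal
  have hexp' : HasExpBound (waveRegion X) Prod.fst
      fun p => ((exp (-p.1) : ℝ) : ℂ) := (HasExpBound.exp_neg waveRegion_fst_nonneg).ofReal
  have h := hasExpBound_riemannKernel (X := X) hb
  have h1 := (h.comp_waveCone_right (k := riemannKernel b)).ofReal
  have h2 := (h.comp_waveCone_left (k := riemannKernel b)).ofReal
  have h3 := hasWaveGrowth_waveIntegral hB (fun X hX => hasExpBound_riemannKernelX hX hb) X hX
  have hV1 := hasExpBound_comp hB (X := X) fun p => p.2 * exp p.1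
  have hV2 := hasExpBound_comp hB (X := X) fun p => p.2 * exp (-p.1)
  have hhalf := HasExpBound.const (S := waveRegion X) (e := Prod.fst) (1 / 2 : ℂ)
  have h5 := hhalf.mul ((hexp.mul (h1.mul hV1)).sub waveRegion_fst_nonneg
    (hexp'.mul (h2.mul hV2)))
  exact h5.add waveRegion_fst_nonneg h3

theorem hasWaveGrowth_waveS {V : ℝ → ℂ} {B : ℝ} (hB : ∀ y, ‖V y‖ ≤ B) {b : ℝ} (hb : 0 ≤ b) :
    HasWaveGrowth (waveS V b) := by
  intro X hX
  have hx := (hasExpBound_waveRegion_x hX).ofReal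
  have hexp : HasExpBound (waveRegion X) Prod.fst
      fun p => ((exp p.1 : ℝ) : ℂ) := HasExpBound.exp_self.ofReal
  have hexp' : HasExpBound (waveRegion X) Prod.fst
      fun p => ((exp (-p.1) : ℝ) : ℂ) := (HasExpBound.exp_neg waveRegion_fst_nonneg).ofReal
  have h := hasExpBound_riemannKernel (X := X) hb
  have h1 := (h.comp_waveCone_right (k := riemannKernel b)).ofReal
  have h2 := (h.comp_waveCone_left (k := riemannKernel b)).ofReal
  have h3 := hasWaveGrowth_waveIntegral hB (fun X hX => hasExpBound_riemannKernelS hX hb) X hX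
  have hV1 := hasExpBound_comp hB (X := X) fun p => p.2 * exp p.1
  have hV2 := hasExpBound_comp hB (X := X) fun p => p.2 * exp (-p.1)
  have hhalf := HasExpBound.const (S := waveRegion X) (e := Prod.fst) (1 / 2 : ℂ)
  have h5 := hhalf.mul (((hx.mul hexp).mul (h1.mul hV1)).add waveRegion_fst_nonneg
    ((hx.mul hexp').mul (h2.mul hV2)))
  exact h5.add waveRegion_fst_nonneg h3

theorem hasWaveGrowth_waveXX {V : ℝ → ℂ} {B B' : ℝ} (hB : ∀ y, ‖V y‖ ≤ B)
    (hB' : ∀ y, ‖deriv V y‖ ≤ B') {b : ℝ} (hb : 0 ≤ b) : HasWaveGrowth (waveXX V b) := by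
  intro X hX
  have hexp : HasExpBound (waveRegion X) Prod.fst
      fun p => ((exp p.1 : ℝ) : ℂ) := HasExpBound.exp_self.ofReal
  have hexp' : HasExpBound (waveRegion X) Prod.fst
      fun p => ((exp (-p.1) : ℝ) : ℂ) := (HasExpBound.exp_neg waveRegion_fst_nonneg).ofReal
  have h := hasExpBound_riemannKernelX hX hb
  have h1 := (h.comp_waveCone_right (k := riemannKernelX b)).ofReal
  have h2 := (h.comp_waveCone_left (k := riemannKernelX b)).ofReal
  have h3 := hasWaveGrowth_waveIntegral hB (fun X hX => hasExpBound_riemannKernelXX hX hb) X hX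
  have hV1 := hasExpBound_comp hB (X := X) fun p => p.2 * exp p.1
  have hV2 := hasExpBound_comp hB (X := X) fun p => p.2 * exp (-p.1)
  have hV3 := hasExpBound_comp hB' (X := X) fun p => p.2 * exp p.1
  have hV4 := hasExpBound_comp hB' (X := X) fun p => p.2 * exp (-p.1)
  have hhalf := HasExpBound.const (S := waveRegion X) (e := Prod.fst) (1 / 2 : ℂ)
  have h4 := hhalf.mul ((hexp.mul (hexp.mul hV3)).sub waveRegion_fst_nonneg
    (hexp'.mul (hexp'.mul hV4)))
  have h5 := hhalf.mul ((hexp.mul (h1.mul hV1)).sub waveRegion_fst_nonneg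
    (hexp'.mul (h2.mul hV2)))
  exact h4.add waveRegion_fst_nonneg (h5.add waveRegion_fst_nonneg h3)

theorem continuous_comp_triple {α : Type*} [TopologicalSpace α] {k : ℝ → ℝ → ℝ → ℝ}
    (hk : Continuous fun p : ℝ × ℝ × ℝ => k p.1 p.2.1 p.2.2) {f g h : α → ℝ} (hf : Continuous f)
    (hg : Continuous g) (hh : Continuous h) : Continuous fun p => k (f p) (g p) (h p) :=
  hk.comp (hf.prodMk (hg.prodMk hh))

theorem isWaveSolution_waveW {V : ℝ → ℂ} (hV : ContDiff ℝ 1 V) {B B' : ℝ} (hB : ∀ y, ‖V y‖ ≤ B)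
    (hB' : ∀ y, ‖deriv V y‖ ≤ B') (a : ℝ) :
    IsWaveSolution a (waveW V (a ^ 2 / 4)) (waveX V (a ^ 2 / 4)) (waveXX V (a ^ 2 / 4))
      (waveS V (a ^ 2 / 4)) (waveSS V (a ^ 2 / 4)) := by
  have hVc := hV.continuous
  have hV'c := hV.continuous_deriv le_rfl
  -- The value `a²/4` makes `4 b = a²` in the equation and agrees with `J₀(z) = φ₀(z²/4)`.
  set b := a ^ 2 / 4 with hb_def
  have hb : 0 ≤ b := by positivity
  constructor
  · exact waveW_zero V b
  · exact fun s x => hasDerivAt_waveIntegral_right hVc (continuous_riemannKernel b)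
      (continuous_riemannKernelX b) (hasDerivAt_riemannKernel_x b) s x
  · intro s x
    have h1 := hasDerivAt_waveIntegral_right hVc (continuous_riemannKernelX b)
      (continuous_riemannKernelXX b) (hasDerivAt_riemannKernelX b) s x
    have h2 := (((hasDerivAt_comp_mul_const hV (exp s) x).const_mul ((exp s : ℝ) : ℂ)).sub
      ((hasDerivAt_comp_mul_const hV (exp (-s)) x).const_mul ((exp (-s) : ℝ) : ℂ))).const_mul
      (1 / 2 : ℂ)
    refine (h2.add h1).congr_of_eventuallyEq (Eventually.of_forall fun x => ?_)
    simp [waveX, riemannKernel_left, riemannKernel_right]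
  · exact fun s x => hasDerivAt_waveIntegral_left hVc (continuous_riemannKernel b)
      (continuous_riemannKernelS b) (hasDerivAt_riemannKernel_s b) s x
  · intro s x
    have h1 := hasDerivAt_waveIntegral_left hVc (continuous_riemannKernelS b)
      (continuous_riemannKernelSS b) (hasDerivAt_riemannKernelS b) s x
    have h3 : HasDerivAt (fun s => ((x * exp s : ℝ) : ℂ)) ((x * exp s : ℝ) : ℂ) s :=
      ((hasDerivAt_exp s).const_mul x).ofReal_comp
    have h4 : HasDerivAt (fun s => ((x * exp (-s) : ℝ) : ℂ)) (-(x * exp (-s)) : ℝ) s := by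
      simpa using ((hasDerivAt_neg s).exp.const_mul x).ofReal_comp
    have h2 := ((h3.mul (hasDerivAt_comp_const_mul_exp hV x s)).add
      (h4.mul (hasDerivAt_comp_const_mul_exp_neg hV x s))).const_mul (1 / 2 : ℂ)
    refine ((h2.add h1).congr_of_eventuallyEq (Eventually.of_forall fun s => ?_)).congr_deriv ?_
    · simp [waveS, riemannKernel_left, riemannKernel_right]
    · rw [waveSS]
      push_cast
      ring
  · exact continuous_waveIntegral hVc (continuous_riemannKernel b)
  · simp_rw [waveX, riemannKernel_left, riemannKernel_right]
    have := continuous_waveIntegral hVc (continuous_riemannKernelX b)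
    fun_prop
  · simp_rw [waveXX]
    have := continuous_waveIntegral hVc (continuous_riemannKernelXX b)
    have h1 := continuous_comp_triple (continuous_riemannKernelX b) continuous_fst continuous_snd
      (by fun_prop : Continuous fun p : ℝ × ℝ => p.2 * exp p.1)
    have h2 := continuous_comp_triple (continuous_riemannKernelX b) continuous_fst continuous_snd
      (by fun_prop : Continuous fun p : ℝ × ℝ => p.2 * exp (-p.1))
    fun_prop
  · exact hasWaveGrowth_waveIntegral hB fun X _ => hasExpBound_riemannKernel hb
  · exact hasWaveGrowth_waveX hB hb
  · exact hasWaveGrowth_waveXX hB hB' hb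
  · exact hasWaveGrowth_waveS hB hb
  · intro s x
    rw [waveSS_eq hVc, hb_def]
    push_cast
    ring

end

/-! ### From the wave equation to the heat equation. -/

noncomputable section

open MeasureTheory Set Real Filter Topology

/-- A weight that decays in `s` faster than any exponential, locally uniformly in `t > 0`. -/
structure IsHeatWeight (k : ℝ → ℝ → ℝ) : Prop where
  cont : ContinuousOn (fun p : ℝ × ℝ => k p.1 p.2) (Ioi 0 ×ˢ univ)
  decay : ∀ t₁ t₂ m : ℝ, 0 < t₁ → 0 ≤ m → ∃ C : ℝ, 0 ≤ C ∧ ∀ t ∈ Icc t₁ t₂, ∀ s, 0 ≤ s →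
    |k t s| ≤ C * exp (-m * s)

theorem IsHeatWeight.add {k l : ℝ → ℝ → ℝ} (hk : IsHeatWeight k) (hl : IsHeatWeight l) :
    IsHeatWeight fun t s => k t s + l t s where
  cont := hk.cont.add hl.cont
  decay t₁ t₂ m ht₁ hm := by
    obtain ⟨C, hC, h⟩ := hk.decay t₁ t₂ m ht₁ hm
    obtain ⟨D, hD, h'⟩ := hl.decay t₁ t₂ m ht₁ hm
    refine ⟨C + D, by positivity, fun t ht s hs => ?_⟩
    rw [add_mul]
    exact (abs_add_le _ _).trans (add_le_add (h t ht s hs) (h' t ht s hs))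

/-- The power costs `n! eˢ`, and completing the square gives `(m + 1) s - s²/(4T) ≤ (m + 1)² T`. -/
theorem pow_mul_exp_neg_sq_div_le (n : ℕ) {t T m s : ℝ} (ht : 0 < t) (htT : t ≤ T) (hs : 0 ≤ s) :
    s ^ n * exp (-s ^ 2 / (4 * t)) ≤ n.factorial * exp ((m + 1) ^ 2 * T) * exp (-m * s) := by
  have hT : 0 < T := ht.trans_le htT
  have h1 : s ^ n ≤ n.factorial * exp s := by
    have h := pow_div_factorial_le_exp s hs n
    rwa [div_le_iff₀ (by positivity), mul_comm] at h
  have h2 : -s ^ 2 / (4 * t) ≤ (m + 1) ^ 2 * T + (-m * s) - s := by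
    have h3 : -s ^ 2 / (4 * t) ≤ -s ^ 2 / (4 * T) := by
      rw [neg_div, neg_div, neg_le_neg_iff]
      gcongr
    refine h3.trans ?_
    rw [div_le_iff₀ (by positivity)]
    nlinarith [sq_nonneg (s - 2 * (m + 1) * T)]
  calc s ^ n * exp (-s ^ 2 / (4 * t)) ≤
      n.factorial * exp s * exp ((m + 1) ^ 2 * T + (-m * s) - s) := by gcongr
    _ = _ := by
      rw [exp_sub, exp_add]
      field_simp

theorem isHeatWeight_pow_mul_exp {c : ℝ → ℝ} (hc : ContinuousOn c (Ioi 0)) (n : ℕ) :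
    IsHeatWeight fun t s => c t * (s ^ n * exp (-s ^ 2 / (4 * t))) where
  cont := by
    refine (hc.comp continuousOn_fst fun p hp => hp.1).mul
      (ContinuousOn.mul (by fun_prop) (ContinuousOn.rexp (ContinuousOn.div (by fun_prop)
        (by fun_prop) fun p hp => ?_)))
    have : 0 < p.1 := hp.1
    positivity
  decay t₁ t₂ m ht₁ hm := by
    obtain ⟨C, hC⟩ := (isCompact_Icc (a := t₁) (b := t₂)).exists_bound_of_continuousOn
      (hc.mono fun t ht => ht₁.trans_le ht.1)
    refine ⟨max C 0 * (n.factorial * exp ((m + 1) ^ 2 * t₂)), by positivity, fun t ht s hs => ?_⟩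
    have ht0 : 0 < t := ht₁.trans_le ht.1
    rw [abs_mul, abs_of_nonneg (by positivity : 0 ≤ s ^ n * exp (-s ^ 2 / (4 * t))), mul_assoc]
    refine mul_le_mul ((hC t ht).trans (le_max_left _ _))
      (pow_mul_exp_neg_sq_div_le n ht0 ht.2 hs) (by positivity) (by positivity)

def heatNorm (t : ℝ) : ℝ := 1 / (2 * √π * t ^ (3 / 2 : ℝ))

/-- This is `-2 ∂ₛ` of the Gauss kernel `e^{-s²/4t} / √(4πt)`. Hence it solves the heat equation in
`(t, s)` and vanishes at `s = 0`. -/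
def heatWeight (t s : ℝ) : ℝ := heatNorm t * (s * exp (-s ^ 2 / (4 * t)))

def heatWeightS (t s : ℝ) : ℝ := heatNorm t * ((1 - s ^ 2 / (2 * t)) * exp (-s ^ 2 / (4 * t)))

/-- One expression serves both as `∂ₜ` and as `∂ₛ²` of `heatWeight`; this coincidence is the heat
equation of the weight. -/
def heatWeightT (t s : ℝ) : ℝ := (s ^ 2 / (4 * t ^ 2) - 3 / (2 * t)) * heatWeight t s

theorem continuousOn_heatNorm : ContinuousOn heatNorm (Ioi 0) := by
  refine continuousOn_const.div (continuousOn_const.mul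
    (continuousOn_id.rpow_const fun t ht => Or.inl (ne_of_gt ht))) fun t ht => ?_
  have : 0 < t := ht
  have : 0 < √π := sqrt_pos.2 pi_pos
  positivity

theorem hasDerivAt_heatNorm {t : ℝ} (ht : 0 < t) :
    HasDerivAt heatNorm (-(3 / (2 * t)) * heatNorm t) t := by
  have hp : 0 < √π := sqrt_pos.2 pi_pos
  have h1 := (hasDerivAt_rpow_const (p := 3 / 2) (Or.inl ht.ne')).const_mul (2 * √π)
  have h2 := h1.inv (by positivity)
  have h3 : heatNorm = fun t => (2 * √π * t ^ (3 / 2 : ℝ))⁻¹ := by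
    funext t
    rw [heatNorm, one_div]
  rw [h3]
  refine h2.congr_deriv ?_
  rw [rpow_sub_one ht.ne']
  have h4 : 0 < t ^ (3 / 2 : ℝ) := by positivity
  field_simp

theorem isHeatWeight_heatWeight : IsHeatWeight heatWeight := by
  have h := isHeatWeight_pow_mul_exp continuousOn_heatNorm 1
  simp only [pow_one] at h
  exact h

theorem isHeatWeight_heatWeightS : IsHeatWeight heatWeightS := by
  have h := (isHeatWeight_pow_mul_exp continuousOn_heatNorm 0).add
    (isHeatWeight_pow_mul_exp (c := fun t => -(heatNorm t / (2 * t)))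
      (continuousOn_heatNorm.div (by fun_prop) fun t ht => by
        have : 0 < t := ht
        positivity).neg 2)
  convert h using 3 with t s
  rw [heatWeightS]
  ring

theorem isHeatWeight_heatWeightT : IsHeatWeight heatWeightT := by
  have h := (isHeatWeight_pow_mul_exp (c := fun t => heatNorm t / (4 * t ^ 2))
      (continuousOn_heatNorm.div (by fun_prop) fun t ht => by
        have : 0 < t := ht
        positivity) 3).add
    (isHeatWeight_pow_mul_exp (c := fun t => -(heatNorm t * 3 / (2 * t)))
      ((continuousOn_heatNorm.mul continuousOn_const).div (by fun_prop) fun t ht => by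
        have : 0 < t := ht
        positivity).neg 1)
  convert h using 3 with t s
  rw [heatWeightT, heatWeight]
  ring

theorem hasDerivAt_exp_neg_sq_div_s (t s : ℝ) :
    HasDerivAt (fun s => exp (-s ^ 2 / (4 * t))) (exp (-s ^ 2 / (4 * t)) * (-(s / (2 * t)))) s := by
  refine (((hasDerivAt_pow 2 s).neg.div_const (4 * t)).exp).congr_deriv ?_
  congr 1
  simp only [Nat.cast_ofNat, Nat.add_one_sub_one, pow_one]
  rw [neg_div, show (4 : ℝ) * t = 2 * (2 * t) by ring, mul_div_mul_left _ _ two_ne_zero]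

theorem hasDerivAt_heatWeight_s (t s : ℝ) :
    HasDerivAt (fun s => heatWeight t s) (heatWeightS t s) s := by
  refine (((hasDerivAt_id s).mul (hasDerivAt_exp_neg_sq_div_s t s)).const_mul
    (heatNorm t)).congr_deriv ?_
  simp only [heatWeightS, id]
  ring

theorem hasDerivAt_heatWeightS {t : ℝ} (ht : 0 < t) (s : ℝ) :
    HasDerivAt (fun s => heatWeightS t s) (heatWeightT t s) s := by
  refine (((((hasDerivAt_pow 2 s).div_const (2 * t)).const_sub 1).mul
    (hasDerivAt_exp_neg_sq_div_s t s)).const_mul (heatNorm t)).congr_deriv ?_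
  simp only [heatWeightT, heatWeight, Nat.cast_ofNat, Nat.add_one_sub_one, pow_one]
  field_simp
  ring

theorem hasDerivAt_heatWeight_t {t : ℝ} (ht : 0 < t) (s : ℝ) :
    HasDerivAt (fun t => heatWeight t s) (heatWeightT t s) t := by
  have h1 : HasDerivAt (fun t : ℝ => -s ^ 2 / (4 * t)) (s ^ 2 / (4 * t ^ 2)) t := by
    have h := (((hasDerivAt_id t).const_mul 4).inv (by simpa using ht.ne')).const_mul (-s ^ 2)
    refine h.congr_deriv ?_
    simp only [id]
    field_simp
  refine ((hasDerivAt_heatNorm ht).mul (h1.exp.const_mul s)).congr_deriv ?_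
  rw [heatWeightT, heatWeight]
  ring

/-- `∫₀^∞ k(t, s) A(s, x) ds`. -/
def heatTransform (k : ℝ → ℝ → ℝ) (A : ℝ → ℝ → ℂ) (t x : ℝ) : ℂ :=
  ∫ s in Ioi (0 : ℝ), (k t s : ℂ) * A s x

section Transform

variable {k : ℝ → ℝ → ℝ} {A : ℝ → ℝ → ℂ}

/-- Decay of the weight at rate `m + 1` against growth `e^{ms}` leaves `e⁻ˢ`, uniformly for `t` in a
compact interval and `x` in `(0, X]`. This is the dominating function for continuity and
differentiation under the integral. -/
theorem IsHeatWeight.exists_bound (hk : IsHeatWeight k) (hA : HasWaveGrowth A) {t₁ t₂ X : ℝ}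
    (ht₁ : 0 < t₁) (hX : 0 < X) :
    ∃ C : ℝ, ∀ t ∈ Icc t₁ t₂, ∀ x ∈ Ioc 0 X, ∀ s, 0 ≤ s →
      ‖(k t s : ℂ) * A s x‖ ≤ C * exp (-s) := by
  obtain ⟨C, m, hC, hm, h⟩ := hA X hX
  obtain ⟨D, hD, h'⟩ := hk.decay t₁ t₂ (m + 1) ht₁ (by linarith)
  refine ⟨D * C, fun t ht x hx s hs => ?_⟩
  rw [norm_mul, Complex.norm_real]
  calc ‖k t s‖ * ‖A s x‖ ≤ D * exp (-(m + 1) * s) * (C * exp (m * s)) :=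
        mul_le_mul (h' t ht s hs) (h (s, x) ⟨hs, hx.1, hx.2⟩) (norm_nonneg _) (by positivity)
    _ = D * C * (exp (-(m + 1) * s) * exp (m * s)) := by ring
    _ = _ := by
        rw [← exp_add]
        ring_nf

theorem integrableOn_const_mul_exp_neg (C : ℝ) :
    IntegrableOn (fun s => C * exp (-s)) (Ioi 0) :=
  (integrableOn_exp_neg_Ioi 0).const_mul C

theorem IsHeatWeight.aestronglyMeasurable (hk : IsHeatWeight k)
    (hA : Continuous fun p : ℝ × ℝ => A p.1 p.2) {t : ℝ} (ht : 0 < t) (x : ℝ) :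
    AEStronglyMeasurable (fun s => (k t s : ℂ) * A s x) (volume.restrict (Ioi 0)) := by
  have h1 : Continuous fun s => k t s := by
    rw [← continuousOn_univ]
    exact hk.cont.comp (by fun_prop : ContinuousOn (fun s : ℝ => (t, s)) univ)
      fun s _ => ⟨ht, mem_univ _⟩
  have h2 : Continuous fun s => A s x := hA.comp (by fun_prop : Continuous fun s : ℝ => (s, x))
  exact ((Complex.continuous_ofReal.comp h1).mul h2).aestronglyMeasurable

theorem IsHeatWeight.integrableOn (hk : IsHeatWeight k)
    (hA : Continuous fun p : ℝ × ℝ => A p.1 p.2) (hg : HasWaveGrowth A) {t x : ℝ} (ht : 0 < t)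
    (hx : 0 < x) : IntegrableOn (fun s => (k t s : ℂ) * A s x) (Ioi 0) := by
  obtain ⟨C, hC⟩ := hk.exists_bound hg ht hx (t₂ := t)
  exact (integrableOn_const_mul_exp_neg C).mono' (hk.aestronglyMeasurable hA ht x)
    ((ae_restrict_iff' measurableSet_Ioi).2 (Eventually.of_forall fun s hs =>
      hC t ⟨le_rfl, le_rfl⟩ x ⟨hx, le_rfl⟩ s (le_of_lt hs)))

theorem continuousOn_heatTransform (hk : IsHeatWeight k)
    (hA : Continuous fun p : ℝ × ℝ => A p.1 p.2) (hg : HasWaveGrowth A) :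
    ContinuousOn (fun p : ℝ × ℝ => heatTransform k A p.1 p.2) (Ioi 0 ×ˢ Ioi 0) := by
  rintro ⟨t, x⟩ ⟨ht, hx⟩
  have ht' : 0 < t := ht
  have hx' : 0 < x := hx
  obtain ⟨C, hC⟩ := hk.exists_bound hg (half_pos ht') (t₂ := 2 * t) (X := 2 * x) (by linarith)
  have hU : ∀ᶠ p : ℝ × ℝ in 𝓝 (t, x), p.1 ∈ Icc (t / 2) (2 * t) ∧ p.2 ∈ Ioc 0 (2 * x) :=
    Eventually.and
      (continuousAt_fst.eventually_mem (Icc_mem_nhds (show t / 2 < t by linarith)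
        (show t < 2 * t by linarith)))
      (continuousAt_snd.eventually_mem (Ioc_mem_nhds hx' (show x < 2 * x by linarith)))
  refine ContinuousAt.continuousWithinAt ?_
  refine continuousAt_of_dominated (bound := fun s => C * exp (-s)) ?_ ?_
    (integrableOn_const_mul_exp_neg C) ?_
  · filter_upwards [hU] with p hp
    exact hk.aestronglyMeasurable hA ((half_pos ht').trans_le hp.1.1) _
  · filter_upwards [hU] with p hp
    exact (ae_restrict_iff' measurableSet_Ioi).2 (Eventually.of_forall fun s hs =>
      hC _ hp.1 _ hp.2 s (le_of_lt hs))
  · refine Eventually.of_forall fun s => ?_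
    have h1 : ContinuousAt (fun p : ℝ × ℝ => k p.1 s) (t, x) := by
      have h := hk.cont.continuousAt (x := (t, s))
        ((isOpen_Ioi.prod isOpen_univ).mem_nhds ⟨ht, mem_univ _⟩)
      exact ContinuousAt.comp (f := fun p : ℝ × ℝ => (p.1, s)) (x := (t, x)) h (by fun_prop)
    have h2 : Continuous fun p : ℝ × ℝ => A s p.2 :=
      hA.comp (by fun_prop : Continuous fun p : ℝ × ℝ => (s, p.2))
    exact (Complex.continuous_ofReal.continuousAt.comp h1).mul h2.continuousAt

theorem hasDerivAt_heatTransform_x {A' : ℝ → ℝ → ℂ} (hk : IsHeatWeight k)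
    (hA : Continuous fun p : ℝ × ℝ => A p.1 p.2) (hg : HasWaveGrowth A)
    (hA' : Continuous fun p : ℝ × ℝ => A' p.1 p.2) (hg' : HasWaveGrowth A')
    (hd : ∀ s x, HasDerivAt (A s) (A' s x) x) {t x : ℝ} (ht : 0 < t) (hx : 0 < x) :
    HasDerivAt (heatTransform k A t) (heatTransform k A' t x) x := by
  obtain ⟨C, hC⟩ := hk.exists_bound hg' ht (t₂ := t) (X := 2 * x) (by linarith)
  refine (hasDerivAt_integral_of_dominated_loc_of_deriv_le (bound := fun s => C * exp (-s))
    (F := fun y s => (k t s : ℂ) * A s y) (F' := fun y s => (k t s : ℂ) * A' s y)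
    (Ioc_mem_nhds hx (show x < 2 * x by linarith))
    (Eventually.of_forall fun y => hk.aestronglyMeasurable hA ht y)
    (hk.integrableOn hA hg ht hx) (hk.aestronglyMeasurable hA' ht x) ?_
    (integrableOn_const_mul_exp_neg C) ?_).2
  · exact (ae_restrict_iff' measurableSet_Ioi).2 (Eventually.of_forall fun s hs y hy =>
      hC t ⟨le_rfl, le_rfl⟩ y hy s (le_of_lt hs))
  · exact Eventually.of_forall fun s y _ => (hd s y).const_mul _

theorem hasDerivAt_heatTransform_t {k' : ℝ → ℝ → ℝ} (hk : IsHeatWeight k)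
    (hk' : IsHeatWeight k') (hA : Continuous fun p : ℝ × ℝ => A p.1 p.2) (hg : HasWaveGrowth A)
    (hd : ∀ t s, 0 < t → HasDerivAt (fun t => k t s) (k' t s) t) {t x : ℝ} (ht : 0 < t)
    (hx : 0 < x) :
    HasDerivAt (fun t => heatTransform k A t x) (heatTransform k' A t x) t := by
  obtain ⟨C, hC⟩ := hk'.exists_bound hg (half_pos ht) (t₂ := 2 * t) hx
  refine (hasDerivAt_integral_of_dominated_loc_of_deriv_le (bound := fun s => C * exp (-s))
    (F := fun τ s => (k τ s : ℂ) * A s x) (F' := fun τ s => (k' τ s : ℂ) * A s x)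
    (Icc_mem_nhds (show t / 2 < t by linarith) (show t < 2 * t by linarith))
    ?_ (hk.integrableOn hA hg ht hx) (hk'.aestronglyMeasurable hA ht x) ?_
    (integrableOn_const_mul_exp_neg C) ?_).2
  · filter_upwards [eventually_gt_nhds ht] with τ hτ
    exact hk.aestronglyMeasurable hA hτ x
  · exact (ae_restrict_iff' measurableSet_Ioi).2 (Eventually.of_forall fun s hs τ hτ =>
      hC τ hτ x ⟨hx, le_rfl⟩ s (le_of_lt hs))
  · exact Eventually.of_forall fun s τ hτ =>
      (hd τ s ((half_pos ht).trans_le hτ.1)).ofReal_comp.mul_const _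

end Transform

section Superposition

variable {a : ℝ} {W Wx Wxx Ws Wss : ℝ → ℝ → ℂ}

/-- Green's identity in `s`: with `k` the weight, `kₛₛ W - k Wₛₛ` is the derivative of `kₛ W - k
Wₛ`. This vanishes at infinity by decay, and at `s = 0` because both `W` and `k` do. -/
theorem IsWaveSolution.heatTransform_heatWeightT (h : IsWaveSolution a W Wx Wxx Ws Wss) {t x : ℝ}
    (ht : 0 < t) (hx : 0 < x) :
    heatTransform heatWeightT W t x = heatTransform heatWeight Wss t x := by
  have hT := isHeatWeight_heatWeightT.integrableOn h.cont h.growth ht hx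
  have hss := isHeatWeight_heatWeight.integrableOn h.cont_ss h.growth_ss ht hx
  let f : ℝ → ℂ := fun s => heatWeightS t s * W s x - heatWeight t s * Ws s x
  have hf : ∀ s, HasDerivAt f (heatWeightT t s * W s x - heatWeight t s * Wss s x) s := by
    intro s
    refine (((hasDerivAt_heatWeightS ht s).ofReal_comp.mul (h.deriv_s s x)).sub
      ((hasDerivAt_heatWeight_s t s).ofReal_comp.mul (h.deriv_ss s x))).congr_deriv ?_
    ring
  have hlim : Tendsto f atTop (𝓝 0) := by
    obtain ⟨C, hC⟩ := isHeatWeight_heatWeightS.exists_bound h.growth ht hx (t₂ := t)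
    obtain ⟨D, hD⟩ := isHeatWeight_heatWeight.exists_bound h.growth_s ht hx (t₂ := t)
    refine squeeze_zero_norm' (a := fun s => (C + D) * exp (-s)) ?_ ?_
    · filter_upwards [eventually_ge_atTop 0] with s hs
      rw [add_mul]
      exact (norm_sub_le _ _).trans (add_le_add (hC t ⟨le_rfl, le_rfl⟩ x ⟨hx, le_rfl⟩ s hs)
        (hD t ⟨le_rfl, le_rfl⟩ x ⟨hx, le_rfl⟩ s hs))
    · simpa using (tendsto_exp_neg_atTop_nhds_zero.const_mul (C + D))
  have hint := integral_Ioi_of_hasDerivAt_of_tendsto (a := 0) (hf 0).continuousAt.continuousWithinAt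
    (fun s _ => hf s) (hT.sub hss) hlim
  rw [integral_sub hT hss] at hint
  have h0 : f 0 = 0 := by simp [f, h.zero, heatWeight]
  rw [h0, sub_zero, sub_eq_zero] at hint
  exact hint

theorem IsWaveSolution.heatTransform_wave (h : IsWaveSolution a W Wx Wxx Ws Wss) {t x : ℝ}
    (ht : 0 < t) (hx : 0 < x) :
    heatTransform heatWeight Wss t x = x ^ 2 * heatTransform heatWeight Wxx t x +
      x * heatTransform heatWeight Wx t x - a ^ 2 * x ^ 2 * heatTransform heatWeight W t x := by
  have h0 := (isHeatWeight_heatWeight.integrableOn h.cont h.growth ht hx).const_mul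
    ((a : ℂ) ^ 2 * x ^ 2)
  have h1 := (isHeatWeight_heatWeight.integrableOn h.cont_x h.growth_x ht hx).const_mul (x : ℂ)
  have h2 := (isHeatWeight_heatWeight.integrableOn h.cont_xx h.growth_xx ht hx).const_mul
    ((x : ℂ) ^ 2)
  have heq : ∀ s, (heatWeight t s : ℂ) * Wss s x = x ^ 2 * (heatWeight t s * Wxx s x) +
      x * (heatWeight t s * Wx s x) - a ^ 2 * x ^ 2 * (heatWeight t s * W s x) := fun s => by
    rw [h.wave]
    ring
  have h12 : Integrable (fun s => (x : ℂ) ^ 2 * (heatWeight t s * Wxx s x) +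
      x * (heatWeight t s * Wx s x)) (volume.restrict (Ioi 0)) := h2.add h1
  simp_rw [heatTransform, heq]
  rw [integral_sub h12 h0, integral_add h2 h1, integral_const_mul, integral_const_mul,
    integral_const_mul]

theorem deriv_eq_of_pos {f f' : ℝ → ℂ} (h : ∀ x, 0 < x → HasDerivAt f (f' x) x) {x : ℝ}
    (hx : 0 < x) : deriv f =ᶠ[𝓝 x] f' := by
  filter_upwards [eventually_gt_nhds hx] with y hy
  exact (h y hy).deriv

/-- Superposition of a solution of the wave equation by Gaussians solves the heat equation. -/
theorem IsWaveSolution.isHeatBesselSolution (h : IsWaveSolution a W Wx Wxx Ws Wss)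
    {u : ℝ → ℝ → ℂ} (hu : ∀ t x, 0 < t → 0 < x → u t x = heatTransform heatWeight W t x)
    {u₀ : ℝ → ℂ}
    (hinit : ∀ x₀ : ℝ, 0 < x₀ →
      Tendsto (fun p : ℝ × ℝ => u p.1 p.2) (𝓝[Ioi 0] 0 ×ˢ 𝓝 x₀) (𝓝 (u₀ x₀))) :
    IsHeatBesselSolution a u₀ u := by
  have hw := isHeatWeight_heatWeight
  have dt : ∀ t x, 0 < t → 0 < x →
      HasDerivAt (fun t => u t x) (heatTransform heatWeightT W t x) t := fun t x ht hx =>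
    (hasDerivAt_heatTransform_t hw isHeatWeight_heatWeightT h.cont h.growth
      (fun t s ht => hasDerivAt_heatWeight_t ht s) ht hx).congr_of_eventuallyEq (by
        filter_upwards [eventually_gt_nhds ht] with τ hτ using hu τ x hτ hx)
  have dx : ∀ t x, 0 < t → 0 < x →
      HasDerivAt (u t) (heatTransform heatWeight Wx t x) x := fun t x ht hx =>
    (hasDerivAt_heatTransform_x hw h.cont h.growth h.cont_x h.growth_x h.deriv_x
      ht hx).congr_of_eventuallyEq (by
        filter_upwards [eventually_gt_nhds hx] with y hy using hu t y ht hy)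
  have dxx : ∀ t x, 0 < t → 0 < x →
      HasDerivAt (deriv (u t)) (heatTransform heatWeight Wxx t x) x := fun t x ht hx =>
    (hasDerivAt_heatTransform_x hw h.cont_x h.growth_x h.cont_xx h.growth_xx h.deriv_xx
      ht hx).congr_of_eventuallyEq (deriv_eq_of_pos (fun y hy => dx t y ht hy) hx)
  constructor
  · exact fun t x ht hx => (dt t x ht hx).differentiableAt
  · exact fun t x ht hx => (dx t x ht hx).differentiableAt
  · exact fun t x ht hx => (dxx t x ht hx).differentiableAt
  · exact (continuousOn_heatTransform isHeatWeight_heatWeightT h.cont h.growth).congr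
      fun p hp => (dt p.1 p.2 hp.1 hp.2).deriv
  · exact (continuousOn_heatTransform hw h.cont_x h.growth_x).congr
      fun p hp => (dx p.1 p.2 hp.1 hp.2).deriv
  · exact (continuousOn_heatTransform hw h.cont_xx h.growth_xx).congr
      fun p hp => (dxx p.1 p.2 hp.1 hp.2).deriv
  · intro t x ht hx
    rw [besselOp, (dt t x ht hx).deriv, (dx t x ht hx).deriv, (dxx t x ht hx).deriv, hu t x ht hx,
      h.heatTransform_heatWeightT ht hx, h.heatTransform_wave ht hx]
  · exact hinit

end Superposition

end

/-! ### The kernel flow as a subordinated wave: bound and initial value. -/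

noncomputable section

open MeasureTheory Set Real Filter Topology

/-- This factorisation turns the range of `s` in the kernel into the cone condition `x e⁻ˢ ≤ x' ≤ x
eˢ`. -/
theorem horocyclicSq_eq (x x' s : ℝ) :
    horocyclicSq x x' s = (x * exp s - x') * (x' - x * exp (-s)) := by
  have h : exp s * exp (-s) = 1 := by rw [← exp_add]; simp
  have h1 : cosh s = 2 * cosh (s / 2) ^ 2 - 1 := by
    have h2 := cosh_two_mul (s / 2)
    have h3 := cosh_sq (s / 2)
    rw [show 2 * (s / 2) = s by ring] at h2
    linarith
  have h2 : cosh (s / 2) ^ 2 = (cosh s + 1) / 2 := by linarith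
  rw [horocyclicSq, h2, cosh_eq]
  linear_combination x ^ 2 * h

theorem besselPhase_eq_mul_horocyclicSq (b s x x' : ℝ) :
    besselPhase b s x x' = b * horocyclicSq x x' s := by
  have h3 : exp s * exp (-s) = 1 := by rw [← exp_add]; simp
  rw [horocyclicSq_eq, besselPhase, cosh_eq]
  linear_combination b * x ^ 2 * h3

theorem horocyclicSq_nonneg_iff {x x' s : ℝ} (hx : 0 < x) (hs : 0 ≤ s) :
    0 ≤ horocyclicSq x x' s ↔ x * exp (-s) ≤ x' ∧ x' ≤ x * exp s := by
  have hle : x * exp (-s) ≤ x * exp s := by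
    gcongr
    linarith
  rw [horocyclicSq_eq]
  constructor
  · intro h
    rcases mul_nonneg_iff.1 h with h | h
    · exact ⟨by linarith, by linarith⟩
    -- Both factors nonpositive means `x eˢ ≤ x' ≤ x e⁻ˢ`, which for `s ≥ 0` forces equality
    -- throughout.
    · exact ⟨by linarith, by linarith⟩
  · exact fun h => mul_nonneg (by linarith) (by linarith)

/-- The integrand of the heat kernel of `L^a` as a function of `(x', s)`. -/
def coneIntegrand (b t x : ℝ) : ℝ × ℝ → ℝ :=
  {p : ℝ × ℝ | x * exp (-p.2) ≤ p.1 ∧ p.1 ≤ x * exp p.2}.indicator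
    fun p => p.2 * exp (-p.2 ^ 2 / (4 * t)) * riemannKernel b p.2 x p.1

theorem measurable_coneIntegrand (b t x : ℝ) : Measurable (coneIntegrand b t x) := by
  have h1 : Continuous fun p : ℝ × ℝ => riemannKernel b p.2 x p.1 :=
    continuous_comp_triple (continuous_riemannKernel b) continuous_snd continuous_const
      continuous_fst
  refine Measurable.indicator (Continuous.measurable (by fun_prop)) ?_
  have h2 : {p : ℝ × ℝ | x * exp (-p.2) ≤ p.1 ∧ p.1 ≤ x * exp p.2} =
      {p : ℝ × ℝ | x * exp (-p.2) ≤ p.1} ∩ {p : ℝ × ℝ | p.1 ≤ x * exp p.2} := by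
    ext p
    rfl
  rw [h2]
  exact (measurableSet_le (by fun_prop) (by fun_prop)).inter
    (measurableSet_le (by fun_prop) (by fun_prop))

theorem abs_coneIntegrand_le {b t x x' s : ℝ} (hb : 0 ≤ b) :
    |coneIntegrand b t x (x', s)| ≤ |s * exp (-s ^ 2 / (4 * t))| := by
  by_cases h : x * exp (-s) ≤ x' ∧ x' ≤ x * exp s
  · rw [coneIntegrand, indicator_of_mem (by exact h), abs_mul]
    exact mul_le_of_le_one_right (abs_nonneg _)
      (abs_besselClifford_zero_le (besselPhase_nonneg hb h.1 h.2))
  · rw [coneIntegrand, indicator_of_notMem (by exact h), abs_zero]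
    exact abs_nonneg _

theorem heatBesselKernel_eq_coneIntegrand {a t x x' : ℝ} (hx : 0 < x) (hx' : 0 < x') :
    heatBesselKernel a t x x' =
      heatNorm t / 2 * ∫ s in Ioi 0, coneIntegrand (a ^ 2 / 4) t x (x', s) := by
  have h1 : ∫ s in heatBesselRange x x', heatBesselIntegrand a t x x' s =
      ∫ s in Ici 0, coneIntegrand (a ^ 2 / 4) t x (x', s) := by
    rw [← integral_indicator (measurableSet_heatBesselRange x x'),
      ← integral_indicator measurableSet_Ici]
    congr 1 with s
    by_cases hs : 0 ≤ s
    · rw [indicator_of_mem (show s ∈ Ici 0 from hs)]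
      by_cases h : 0 ≤ horocyclicSq x x' s
      · rw [indicator_of_mem (by rw [heatBesselRange_subset hx hx']; exact ⟨hs, h⟩),
          coneIntegrand, indicator_of_mem (by exact (horocyclicSq_nonneg_iff hx hs).1 h),
          heatBesselIntegrand, ← horocyclicSq, besselJ0_abs_mul_sqrt a h, riemannKernel,
          besselPhase_eq_mul_horocyclicSq]
      · rw [indicator_of_notMem (by rw [heatBesselRange_subset hx hx']; exact fun h' => h h'.2),
          coneIntegrand, indicator_of_notMem (by
            exact fun h' => h ((horocyclicSq_nonneg_iff hx hs).2 h'))]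
    · rw [indicator_of_notMem (show s ∉ Ici 0 from hs), indicator_of_notMem fun h => hs h.1]
  rw [heatBesselKernel, h1, integral_Ici_eq_integral_Ioi, heatNorm]
  congr 1
  rw [div_div]
  ring

section Flow

variable {V : ℝ → ℂ}

theorem integrable_coneIntegrand_mul (hV : Integrable V) {b t : ℝ} (hb : 0 ≤ b) (ht : 0 < t)
    (x : ℝ) :
    Integrable (fun p : ℝ × ℝ => (coneIntegrand b t x p : ℂ) * V p.1)
      ((volume.restrict (Ioi 0)).prod (volume.restrict (Ioi 0))) := by
  have h1 : Integrable (fun s : ℝ => ((s * exp (-s ^ 2 / (4 * t)) : ℝ) : ℂ))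
      (volume.restrict (Ioi 0)) := (integrable_mul_exp_neg_sq_div ht).restrict.ofReal
  have h := (hV.restrict (s := Ioi 0)).mul_prod h1
  refine h.mono ?_ (Eventually.of_forall fun p => ?_)
  · exact (Complex.measurable_ofReal.comp
      (measurable_coneIntegrand b t x)).aestronglyMeasurable.mul
      (hV.restrict (s := Ioi 0)).aestronglyMeasurable.comp_fst
  · rw [norm_mul, norm_mul, mul_comm]
    gcongr
    rw [Complex.norm_real, Complex.norm_real]
    exact abs_coneIntegrand_le hb

theorem kernel_mul_eq {u₀ : ℝ → ℂ} {a t x x' : ℝ} (hx : 0 < x) (hx' : 0 < x') :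
    (heatBesselKernel a t x x' : ℂ) * u₀ x' / (x' : ℂ) =
      (heatNorm t / 2 : ℂ) *
        ∫ s in Ioi 0, (coneIntegrand (a ^ 2 / 4) t x (x', s) : ℂ) * (u₀ x' / x') := by
  rw [heatBesselKernel_eq_coneIntegrand hx hx', integral_mul_const, integral_complex_ofReal]
  push_cast
  ring

theorem integrableOn_heatBesselKernel_mul {u₀ : ℝ → ℂ} (hV : Integrable fun y : ℝ => u₀ y / y)
    {a t x : ℝ} (ht : 0 < t) (hx : 0 < x) :
    IntegrableOn (fun x' : ℝ => (heatBesselKernel a t x x' : ℂ) * u₀ x' / (x' : ℂ)) (Ioi 0) :=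
  ((integrable_coneIntegrand_mul hV (b := a ^ 2 / 4) (by positivity) ht
    x).integral_prod_left.const_mul (heatNorm t / 2 : ℂ)).congr
    ((ae_restrict_iff' measurableSet_Ioi).2 (Eventually.of_forall fun _ hx' =>
      (kernel_mul_eq hx hx').symm))

/-- Fubini applies because `|φ₀| ≤ 1` on the cone bounds the double integrand by a product of
integrable functions. For fixed `s`, the `x'`-integral is then the wave solution with `V(y) =
u₀(y)/y`. -/
theorem heatBesselFlow_eq_heatTransform {u₀ : ℝ → ℂ} (hV : Integrable fun y : ℝ => u₀ y / y)
    {a t x : ℝ} (ht : 0 < t) (hx : 0 < x) :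
    heatBesselFlow a u₀ t x =
      heatTransform heatWeight (waveW (fun y => u₀ y / y) (a ^ 2 / 4)) t x := by
  rw [heatBesselFlow, setIntegral_congr_fun measurableSet_Ioi fun x' hx' =>
    kernel_mul_eq (a := a) (t := t) (u₀ := u₀) hx hx', integral_const_mul,
    integral_integral_swap (integrable_coneIntegrand_mul hV (b := a ^ 2 / 4) (by positivity) ht x),
    ← integral_const_mul, heatTransform]
  refine setIntegral_congr_fun measurableSet_Ioi fun s hs => ?_
  have hs' : 0 < s := hs
  have hle : x * exp (-s) ≤ x * exp s := by
    gcongr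
    linarith
  have h1 : ∫ x' in Ioi 0, (coneIntegrand (a ^ 2 / 4) t x (x', s) : ℂ) * (u₀ x' / x') =
      (s * exp (-s ^ 2 / (4 * t)) : ℝ) * ∫ x' in x * exp (-s)..x * exp s,
        (riemannKernel (a ^ 2 / 4) s x x' : ℂ) * (u₀ x' / x') := by
    rw [intervalIntegral.integral_of_le hle, ← integral_Icc_eq_integral_Ioc, ← integral_const_mul,
      ← integral_indicator measurableSet_Ioi, ← integral_indicator measurableSet_Icc]
    congr 1 with x'
    by_cases h : x' ∈ Icc (x * exp (-s)) (x * exp s)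
    · have h0 : x' ∈ Ioi 0 := lt_of_lt_of_le (by positivity) h.1
      rw [indicator_of_mem h, indicator_of_mem h0, coneIntegrand, indicator_of_mem (by exact h)]
      push_cast
      ring
    · rw [indicator_of_notMem h]
      refine indicator_apply_eq_zero.2 fun _ => ?_
      rw [coneIntegrand, indicator_of_notMem (by exact h)]
      simp
  rw [h1, waveW, waveIntegral, heatWeight]
  push_cast
  ring

/-- The mean value `½ ∫₋₁¹ Φ(s, x, x e^{sη}) u₀(x e^{sη}) dη`. -/
def waveMean (u₀ : ℝ → ℂ) (b s x : ℝ) : ℂ :=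
  1 / 2 * ∫ η in (-1 : ℝ)..1, (riemannKernel b s x (x * exp (s * η)) : ℂ) * u₀ (x * exp (s * η))

theorem continuous_waveMean {u₀ : ℝ → ℂ} (hu : Continuous u₀) (b : ℝ) :
    Continuous fun p : ℝ × ℝ => waveMean u₀ b p.1 p.2 := by
  have h1 := continuous_comp_triple (α := (ℝ × ℝ) × ℝ) (continuous_riemannKernel b)
    (f := fun w => w.1.1) (g := fun w => w.1.2) (h := fun w => w.1.2 * exp (w.1.1 * w.2))
    (by fun_prop) (by fun_prop) (by fun_prop)
  refine continuous_const.mul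
    (intervalIntegral.continuous_parametric_intervalIntegral_of_continuous'
      (f := fun (p : ℝ × ℝ) η => (riemannKernel b p.1 p.2 (p.2 * exp (p.1 * η)) : ℂ) *
        u₀ (p.2 * exp (p.1 * η))) ?_ _ _)
  exact (Complex.continuous_ofReal.comp h1).mul (hu.comp (by fun_prop))

theorem continuous_comp_pair {α : Type*} [TopologicalSpace α] {A : ℝ → ℝ → ℂ}
    (hA : Continuous fun p : ℝ × ℝ => A p.1 p.2) {f g : α → ℝ} (hf : Continuous f)
    (hg : Continuous g) : Continuous fun p => A (f p) (g p) :=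
  hA.comp (hf.prodMk hg)

/-- Under `y = x e^{sη}` the measure `dy/y` becomes `s dη`. The extracted factor `s` combines with
the weight to give the density `heatProfile`. -/
theorem waveW_eq_mul_waveMean {u₀ : ℝ → ℂ} (hV : Continuous fun y : ℝ => u₀ y / y) (b s : ℝ)
    {x : ℝ} (hx : 0 < x) :
    waveW (fun y => u₀ y / y) b s x = s * waveMean u₀ b s x := by
  have hd : ∀ η : ℝ, HasDerivAt (fun η => x * exp (s * η)) (x * exp (s * η) * s) η := fun η => by
    refine ((((hasDerivAt_id η).const_mul s).exp).const_mul x).congr_deriv ?_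
    simp only [id]
    ring
  have hg : Continuous fun y => (riemannKernel b s x y : ℂ) * (u₀ y / y) :=
    (Complex.continuous_ofReal.comp (continuous_comp_triple (continuous_riemannKernel b)
      continuous_const continuous_const continuous_id)).mul hV
  have h := intervalIntegral.integral_deriv_smul_comp (a := -1) (b := 1) (fun η _ => hd η)
    (Continuous.continuousOn (by fun_prop)) hg
  simp only [mul_neg, mul_one] at h
  rw [waveW, waveIntegral, waveMean, ← h, ← mul_assoc, mul_comm (s : ℂ), mul_assoc]
  congr 1
  rw [← intervalIntegral.integral_const_mul]
  congr 1 with η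
  have hx' : (x : ℂ) ≠ 0 := by exact_mod_cast hx.ne'
  simp only [Function.comp, Complex.real_smul]
  push_cast
  field_simp

theorem norm_waveMean_le {u₀ : ℝ → ℂ} {M : ℝ} (hM : ∀ y, ‖u₀ y‖ ≤ M) {b s x : ℝ} (hb : 0 ≤ b)
    (hs : 0 ≤ s) (hx : 0 < x) : ‖waveMean u₀ b s x‖ ≤ M := by
  have h : ‖∫ η in (-1 : ℝ)..1, (riemannKernel b s x (x * exp (s * η)) : ℂ) *
      u₀ (x * exp (s * η))‖ ≤ M * |1 - (-1)| := by
    refine intervalIntegral.norm_integral_le_of_norm_le_const fun η hη => ?_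
    rw [uIoc_of_le (by norm_num)] at hη
    rw [norm_mul, Complex.norm_real]
    have h1 : |riemannKernel b s x (x * exp (s * η))| ≤ 1 := by
      refine abs_besselClifford_zero_le (besselPhase_nonneg hb ?_ ?_)
      · gcongr
        nlinarith [hη.1]
      · gcongr
        nlinarith [hη.2]
    calc _ ≤ 1 * M := mul_le_mul h1 (hM _) (norm_nonneg _) zero_le_one
      _ = M := one_mul M
  rw [waveMean, norm_mul]
  have h2 : |(1 : ℝ) - (-1)| = 2 := by norm_num
  rw [h2] at h
  have h3 : ‖(1 / 2 : ℂ)‖ = 1 / 2 := by simp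
  rw [h3]
  linarith

theorem waveMean_zero (u₀ : ℝ → ℂ) (b x : ℝ) : waveMean u₀ b 0 x = u₀ x := by
  have h := riemannKernel_right b 0 x
  simp only [exp_zero, mul_one] at h
  simp [waveMean, h]
  ring

/-- The profile `σ² e^{-σ²/4} / (2√π)` of the heat weight in the variable `σ = s / √t`. -/
def heatProfile (σ : ℝ) : ℝ := 1 / (2 * √π) * (σ ^ (2 : ℝ) * exp (-(1 / 4) * σ ^ (2 : ℝ)))

theorem integral_heatProfile : ∫ σ in Ioi 0, heatProfile σ = 1 := by
  simp_rw [heatProfile]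
  -- The real exponents in `heatProfile` allow this Gamma integral, with `Γ(3/2) = √π / 2` and
  -- `(1/4)^{-3/2} = 8`.
  rw [integral_const_mul, integral_rpow_mul_exp_neg_mul_rpow (by norm_num) (by norm_num)
    (by norm_num)]
  have h1 : Gamma ((2 + 1) / 2) = √π / 2 := by
    rw [show ((2 : ℝ) + 1) / 2 = 1 / 2 + 1 by norm_num, Gamma_add_one (by norm_num),
      Gamma_one_half_eq]
    ring
  have h2 : (1 / 4 : ℝ) ^ (-((2 : ℝ) + 1) / 2) = 8 := by
    rw [show (1 / 4 : ℝ) = 2 ^ (-2 : ℝ) by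
      rw [rpow_neg (by norm_num)]
      norm_num, ← rpow_mul (by norm_num)]
    norm_num
  have hp : 0 < √π := sqrt_pos.2 pi_pos
  rw [h1, h2]
  field_simp
  norm_num

theorem heatProfile_nonneg {σ : ℝ} (hσ : 0 ≤ σ) : 0 ≤ heatProfile σ := by
  unfold heatProfile
  positivity

theorem continuous_heatProfile : Continuous heatProfile := by
  have h : heatProfile = fun σ => 1 / (2 * √π) * (σ ^ 2 * exp (-(1 / 4) * σ ^ 2)) := by
    funext σ
    simp only [heatProfile, rpow_two]
  rw [h]
  fun_prop

/-- A non-integrable function would have integral `0` by convention, but this integral is 1. -/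
theorem integrableOn_heatProfile : IntegrableOn heatProfile (Ioi 0) := by
  by_contra h
  have h1 := integral_heatProfile
  rw [integral_undef h] at h1
  exact zero_ne_one h1

theorem heatWeight_mul_sqrt {t : ℝ} (ht : 0 < t) (σ : ℝ) :
    heatWeight t (√t * σ) * (√t * σ) * √t = heatProfile σ := by
  have hs : 0 < √t := sqrt_pos.2 ht
  have h1 : t ^ (3 / 2 : ℝ) = √t * √t * √t := by
    rw [show (3 / 2 : ℝ) = 1 + 1 / 2 by norm_num, rpow_add ht, rpow_one, ← sqrt_eq_rpow,
      mul_self_sqrt ht.le]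
  have h2 : -(√t * σ) ^ 2 / (4 * t) = -(1 / 4) * σ ^ 2 := by
    rw [mul_pow, sq_sqrt ht.le]
    field_simp
  have hp : 0 < √π := sqrt_pos.2 pi_pos
  rw [heatWeight, heatNorm, heatProfile, h1, h2, rpow_two]
  field_simp

theorem heatBesselFlow_eq_integral_waveMean {u₀ : ℝ → ℂ}
    (hV : Continuous fun y : ℝ => u₀ y / y) (hVi : Integrable fun y : ℝ => u₀ y / y)
    {a t x : ℝ} (ht : 0 < t) (hx : 0 < x) :
    heatBesselFlow a u₀ t x =
      ∫ σ in Ioi 0, (heatProfile σ : ℂ) * waveMean u₀ (a ^ 2 / 4) (√t * σ) x := by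
  have hs : 0 < √t := sqrt_pos.2 ht
  rw [heatBesselFlow_eq_heatTransform hVi ht hx, heatTransform]
  have h := integral_comp_mul_left_Ioi'
    (fun s => (heatWeight t s : ℂ) * waveW (fun y => u₀ y / y) (a ^ 2 / 4) s x) 0 hs
  rw [mul_zero] at h
  rw [← h, ← integral_smul]
  congr 1 with σ
  rw [waveW_eq_mul_waveMean hV _ _ hx, Complex.real_smul, ← heatWeight_mul_sqrt ht]
  push_cast
  ring

theorem norm_heatBesselFlow_le {u₀ : ℝ → ℂ}
    (hV : Continuous fun y : ℝ => u₀ y / y) (hVi : Integrable fun y : ℝ => u₀ y / y) {M : ℝ}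
    (hM : ∀ y, ‖u₀ y‖ ≤ M) {a t x : ℝ} (ht : 0 < t) (hx : 0 < x) :
    ‖heatBesselFlow a u₀ t x‖ ≤ M := by
  rw [heatBesselFlow_eq_integral_waveMean hV hVi ht hx]
  have h := norm_integral_le_of_norm_le (integrableOn_heatProfile.mul_const M)
    (f := fun σ => (heatProfile σ : ℂ) * waveMean u₀ (a ^ 2 / 4) (√t * σ) x)
    ((ae_restrict_iff' measurableSet_Ioi).2 (Eventually.of_forall fun σ hσ => by
      have hσ' : 0 < σ := hσ
      rw [norm_mul, Complex.norm_real, Real.norm_of_nonneg (heatProfile_nonneg hσ'.le)]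
      exact mul_le_mul_of_nonneg_left (norm_waveMean_le hM (by positivity) (by positivity) hx)
        (heatProfile_nonneg hσ'.le)))
  rwa [integral_mul_const, integral_heatProfile, one_mul] at h

/-- Dominated convergence: `waveMean` is jointly continuous up to `s = 0`, where it equals `u₀`, and
`heatProfile` has total mass 1. -/
theorem tendsto_heatBesselFlow {u₀ : ℝ → ℂ} (hu : Continuous u₀)
    (hV : Continuous fun y : ℝ => u₀ y / y) (hVi : Integrable fun y : ℝ => u₀ y / y) {M : ℝ}
    (hM : ∀ y, ‖u₀ y‖ ≤ M) (a : ℝ) {x₀ : ℝ} (hx₀ : 0 < x₀) :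
    Tendsto (fun p : ℝ × ℝ => heatBesselFlow a u₀ p.1 p.2) (𝓝[Ioi 0] 0 ×ˢ 𝓝 x₀) (𝓝 (u₀ x₀)) := by
  have hpos : ∀ᶠ p : ℝ × ℝ in 𝓝[Ioi 0] 0 ×ˢ 𝓝 x₀, 0 < p.1 ∧ 0 < p.2 :=
    prod_mem_prod self_mem_nhdsWithin (Ioi_mem_nhds hx₀)
  have hQ := continuous_waveMean hu (a ^ 2 / 4)
  have hcong : (fun p : ℝ × ℝ => ∫ σ in Ioi 0,
      (heatProfile σ : ℂ) * waveMean u₀ (a ^ 2 / 4) (√p.1 * σ) p.2) =ᶠ[𝓝[Ioi 0] 0 ×ˢ 𝓝 x₀]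
      fun p => heatBesselFlow a u₀ p.1 p.2 := by
    filter_upwards [hpos] with p hp
    exact (heatBesselFlow_eq_integral_waveMean hV hVi hp.1 hp.2).symm
  refine Tendsto.congr' hcong ?_
  have hlim : ∫ σ in Ioi 0, (heatProfile σ : ℂ) * u₀ x₀ = u₀ x₀ := by
    rw [integral_mul_const, integral_complex_ofReal, integral_heatProfile]
    simp
  rw [← hlim]
  refine tendsto_integral_filter_of_dominated_convergence (fun σ => heatProfile σ * M) ?_ ?_
    (integrableOn_heatProfile.mul_const M) ?_
  · refine Eventually.of_forall fun p => Continuous.aestronglyMeasurable ?_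
    exact (Complex.continuous_ofReal.comp continuous_heatProfile).mul
      (continuous_comp_pair hQ (by fun_prop) continuous_const)
  · filter_upwards [hpos] with p hp
    refine (ae_restrict_iff' measurableSet_Ioi).2 (Eventually.of_forall fun σ hσ => ?_)
    have hσ' : 0 < σ := hσ
    rw [norm_mul, Complex.norm_real, Real.norm_of_nonneg (heatProfile_nonneg hσ'.le)]
    exact mul_le_mul_of_nonneg_left (norm_waveMean_le hM (by positivity) (by positivity) hp.2)
      (heatProfile_nonneg hσ'.le)
  · refine Eventually.of_forall fun σ => Tendsto.const_mul _ ?_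
    have h1 : Tendsto (fun p : ℝ × ℝ => (√p.1 * σ, p.2)) (𝓝[Ioi 0] 0 ×ˢ 𝓝 x₀) (𝓝 (0, x₀)) := by
      have h2 : Continuous fun p : ℝ × ℝ => (√p.1 * σ, p.2) := by fun_prop
      have h3 := h2.tendsto (0, x₀)
      simp only [sqrt_zero, zero_mul] at h3
      refine h3.mono_left ?_
      rw [nhds_prod_eq]
      exact prod_mono nhdsWithin_le_nhds le_rfl
    have h4 := (hQ.tendsto (0, x₀)).comp h1
    simp only [waveMean_zero] at h4
    exact h4

end Flow

end

/-! ### The maximum principle and uniqueness under Gaussian growth. -/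

noncomputable section

open MeasureTheory Set Real Filter Topology

/-- A positive second derivative would make the point a local minimum too, hence the function
locally constant with second derivative 0. -/
theorem second_deriv_nonpos_of_isLocalMax {f f' : ℝ → ℝ} {f'' x₀ : ℝ}
    (hf : ∀ x, HasDerivAt f (f' x) x) (hf' : HasDerivAt f' f'' x₀) (hmax : IsLocalMax f x₀) :
    f'' ≤ 0 := by
  by_contra! h
  have h1 : deriv f = f' := funext fun x => (hf x).deriv
  have hmin : IsLocalMin f x₀ := isLocalMin_of_deriv_deriv_pos (by rwa [h1, hf'.deriv])
    hmax.deriv_eq_zero (hf x₀).continuousAt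
  have hconst : f =ᶠ[𝓝 x₀] fun _ => f x₀ := by
    filter_upwards [hmax, hmin] with x h2 h3 using le_antisymm h2 h3
  have h4 : deriv f =ᶠ[𝓝 x₀] fun _ => 0 := by
    simpa using hconst.deriv
  have h5 := h4.deriv_eq
  rw [h1, hf'.deriv] at h5
  simp at h5
  exact h.ne' h5

/-- Only earlier times are compared, since the maximum may sit at the final time of the rectangle.
-/
theorem deriv_nonneg_of_left_max {f : ℝ → ℝ} {f' t₀ : ℝ} (hf : HasDerivAt f f' t₀)
    (hmax : ∀ᶠ t in 𝓝[<] t₀, f t ≤ f t₀) : 0 ≤ f' := by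
  have h := (hasDerivWithinAt_iff_tendsto_slope' (s := Iio t₀) (by simp)).1 hf.hasDerivWithinAt
  refine ge_of_tendsto h ?_
  filter_upwards [hmax, self_mem_nhdsWithin] with t h1 h2
  have h2' : t < t₀ := h2
  rw [slope_def_field]
  exact div_nonneg_of_nonpos (by linarith) (by linarith)

/-- A strict supersolution of the heat equation with Gaussian growth. -/
def gaussianBarrier (k t w : ℝ) : ℝ := exp ((k + 16 * k ^ 2 * t) * w ^ 2 + 5 * k * t)

theorem hasDerivAt_gaussianBarrier_t (k t w : ℝ) :
    HasDerivAt (fun t => gaussianBarrier k t w)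
      ((16 * k ^ 2 * w ^ 2 + 5 * k) * gaussianBarrier k t w) t := by
  have h1 := ((((hasDerivAt_id t).const_mul (16 * k ^ 2)).const_add k).mul_const (w ^ 2)).add
    ((hasDerivAt_id t).const_mul (5 * k))
  refine h1.exp.congr_deriv ?_
  simp only [gaussianBarrier, Pi.add_apply, id]
  ring

theorem hasDerivAt_gaussianBarrier_w (k t w : ℝ) :
    HasDerivAt (fun w => gaussianBarrier k t w)
      (2 * (k + 16 * k ^ 2 * t) * w * gaussianBarrier k t w) w := by
  have h1 := ((hasDerivAt_pow 2 w).const_mul (k + 16 * k ^ 2 * t)).add_const (5 * k * t)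
  refine h1.exp.congr_deriv ?_
  simp only [gaussianBarrier, Nat.cast_ofNat, Nat.add_one_sub_one, pow_one]
  ring

theorem hasDerivAt_gaussianBarrier_ww (k t w : ℝ) :
    HasDerivAt (fun w => 2 * (k + 16 * k ^ 2 * t) * w * gaussianBarrier k t w)
      ((2 * (k + 16 * k ^ 2 * t) + 4 * (k + 16 * k ^ 2 * t) ^ 2 * w ^ 2) * gaussianBarrier k t w)
      w := by
  have h1 := ((hasDerivAt_id w).const_mul (2 * (k + 16 * k ^ 2 * t))).mul
    (hasDerivAt_gaussianBarrier_w k t w)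
  refine h1.congr_deriv ?_
  simp only [id]
  ring

/-- The time restriction keeps `A = k + 16 k² t` at most `2k`, so that `4A² ≤ 16k²` and `2A ≤ 4k <
5k`. This is the reason for the constants 16 and 5 in the barrier. -/
theorem gaussianBarrier_strict {k t : ℝ} (w : ℝ) (hk : 0 < k) (ht : 0 ≤ t) (htk : 16 * k * t ≤ 1) :
    (2 * (k + 16 * k ^ 2 * t) + 4 * (k + 16 * k ^ 2 * t) ^ 2 * w ^ 2) * gaussianBarrier k t w <
      (16 * k ^ 2 * w ^ 2 + 5 * k) * gaussianBarrier k t w := by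
  have hA : k + 16 * k ^ 2 * t ≤ 2 * k := by nlinarith
  have hA0 : 0 ≤ k + 16 * k ^ 2 * t := by positivity
  refine mul_lt_mul_of_pos_right ?_ (exp_pos _)
  have h1 : (k + 16 * k ^ 2 * t) ^ 2 ≤ (2 * k) ^ 2 := by gcongr
  nlinarith [mul_le_mul_of_nonneg_right h1 (sq_nonneg w)]

theorem continuous_gaussianBarrier (k : ℝ) :
    Continuous fun v : ℝ × ℝ => gaussianBarrier k v.1 v.2 := by
  unfold gaussianBarrier
  fun_prop

/-- The zero initial values extend the function continuously to `t = 0`, so that a maximum exists on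
a closed rectangle. -/
theorem continuousOn_extend_zero {p : ℝ → ℝ → ℝ}
    (cont : ContinuousOn (fun v : ℝ × ℝ => p v.1 v.2) (Ioi 0 ×ˢ univ))
    (init : ∀ w₀, Tendsto (fun v : ℝ × ℝ => p v.1 v.2) (𝓝[Ioi 0] 0 ×ˢ 𝓝 w₀) (𝓝 0)) :
    ContinuousOn (fun v : ℝ × ℝ => if 0 < v.1 then p v.1 v.2 else 0) (Ici 0 ×ˢ univ) := by
  rintro ⟨t, w⟩ ⟨ht, -⟩
  have ht' : 0 ≤ t := ht
  refine ContinuousAt.continuousWithinAt ?_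
  rcases ht'.eq_or_lt with rfl | ht0
  · rw [Metric.continuousAt_iff']
    intro ε hε
    have h1 := (Metric.tendsto_nhds.1 (init w)) ε hε
    rw [← nhdsWithin_univ w, ← nhdsWithin_prod_eq, eventually_nhdsWithin_iff] at h1
    filter_upwards [h1] with v hv
    by_cases h : 0 < v.1
    · simpa [h] using hv ⟨h, mem_univ _⟩
    · simpa [h] using hε
  · have h1 := cont.continuousAt (x := (t, w)) ((isOpen_Ioi.prod isOpen_univ).mem_nhds
      ⟨ht0, mem_univ _⟩)
    refine h1.congr ?_
    filter_upwards [continuousAt_fst.eventually_mem (Ioi_mem_nhds ht0)] with v hv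
    rw [if_pos (show 0 < v.1 from hv)]

/-- The maximum principle for subsolutions of the heat equation on the line, for Gaussian growth
and short times. -/
theorem heat_maximum_principle {p pt px pxx : ℝ → ℝ → ℝ} {k τ C c : ℝ} (hk : 0 < k)
    (hτ : 16 * k * τ ≤ 1) (hck : c + 1 ≤ k)
    (dt : ∀ t w, 0 < t → HasDerivAt (fun t => p t w) (pt t w) t)
    (dx : ∀ t w, 0 < t → HasDerivAt (p t) (px t w) w)
    (dxx : ∀ t w, 0 < t → HasDerivAt (px t) (pxx t w) w)
    (sub : ∀ t w, 0 < t → 0 < p t w → pt t w ≤ pxx t w)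
    (cont : ContinuousOn (fun v : ℝ × ℝ => p v.1 v.2) (Ioi 0 ×ˢ univ))
    (init : ∀ w₀, Tendsto (fun v : ℝ × ℝ => p v.1 v.2) (𝓝[Ioi 0] 0 ×ˢ 𝓝 w₀) (𝓝 0))
    (growth : ∀ t w, 0 < t → t ≤ τ → p t w ≤ C * exp (c * w ^ 2)) {t₁ w₁ : ℝ} (ht₁ : 0 < t₁)
    (ht₁τ : t₁ ≤ τ) : p t₁ w₁ ≤ 0 := by
  suffices H : ∀ μ : ℝ, 0 < μ → p t₁ w₁ ≤ μ * gaussianBarrier k t₁ w₁ by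
    by_contra! h
    have hB : 0 < gaussianBarrier k t₁ w₁ := exp_pos _
    have h1 := H (p t₁ w₁ / (2 * gaussianBarrier k t₁ w₁)) (by positivity)
    have h2 : p t₁ w₁ / (2 * gaussianBarrier k t₁ w₁) * gaussianBarrier k t₁ w₁ =
        p t₁ w₁ / 2 := by field_simp
    linarith
  intro μ hμ
  by_contra! hcon
  -- The rectangle must contain `w₁` and be so wide that `C ≤ μ e^{L²}`; then the barrier dominates
  -- on the lateral sides, one unit of `k` above `c` being spent on `e^{w²}`.
  set L : ℝ := |w₁| + |C| / μ + 1 with hL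
  have hL1 : 1 ≤ L := by
    have h1 : 0 ≤ |w₁| := abs_nonneg _
    have h2 : 0 ≤ |C| / μ := by positivity
    linarith
  have hside : ∀ t w, 0 < t → t ≤ τ → w ^ 2 = L ^ 2 → p t w ≤ μ * gaussianBarrier k t w := by
    intro t w ht htτ hw
    have hC : C ≤ μ * exp (w ^ 2) := by
      have h1 : L ≤ exp (w ^ 2) := by
        rw [hw]
        nlinarith [add_one_le_exp (L ^ 2)]
      have h2 : |C| / μ ≤ L := by
        have := abs_nonneg w₁
        linarith
      have h3 : |C| ≤ μ * exp (w ^ 2) := by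
        rw [div_le_iff₀ hμ] at h2
        nlinarith
      exact (le_abs_self C).trans h3
    calc p t w ≤ C * exp (c * w ^ 2) := growth t w ht htτ
      _ ≤ μ * exp (w ^ 2) * exp (c * w ^ 2) := by gcongr
      _ = μ * exp (w ^ 2 + c * w ^ 2) := by rw [mul_assoc, ← exp_add]
      _ ≤ μ * gaussianBarrier k t w := by
        refine mul_le_mul_of_nonneg_left (exp_le_exp.2 ?_) hμ.le
        have h1 : (c + 1) * w ^ 2 ≤ k * w ^ 2 := by gcongr
        have h2 : 0 ≤ 16 * k ^ 2 * t * w ^ 2 := by positivity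
        have h3 : 0 ≤ 5 * k * t := by positivity
        nlinarith
  let f : ℝ × ℝ → ℝ := fun v =>
    (if 0 < v.1 then p v.1 v.2 else 0) - μ * gaussianBarrier k v.1 v.2
  have hfc : ContinuousOn f (Icc 0 t₁ ×ˢ Icc (-L) L) :=
    ((continuousOn_extend_zero cont init).mono
      (prod_mono (fun t ht => ht.1) (subset_univ _))).sub
      (continuousOn_const.mul (continuous_gaussianBarrier k).continuousOn)
  have hmem : (t₁, w₁) ∈ Icc 0 t₁ ×ˢ Icc (-L) L := by
    have h2 : 0 ≤ |C| / μ := by positivity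
    exact ⟨⟨ht₁.le, le_rfl⟩, abs_le.1 (by linarith)⟩
  obtain ⟨⟨t, w⟩, ⟨htm, hwm⟩, hmax⟩ :=
    (isCompact_Icc.prod isCompact_Icc).exists_isMaxOn ⟨_, hmem⟩ hfc
  have hfpos : 0 < f (t, w) := by
    refine lt_of_lt_of_le ?_ (hmax hmem)
    simp only [f, if_pos ht₁]
    linarith
  have hB : 0 < μ * gaussianBarrier k t w := mul_pos hμ (exp_pos _)
  -- At `t = 0` the function `f` is minus the barrier, hence negative, so a positive maximum lies at
  -- positive time.
  have ht : 0 < t := by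
    by_contra h
    simp only [f, if_neg h] at hfpos
    linarith
  have hf : f (t, w) = p t w - μ * gaussianBarrier k t w := by simp only [f, if_pos ht]
  rw [hf] at hfpos
  have htτ : t ≤ τ := htm.2.trans ht₁τ
  have hwL : -L < w ∧ w < L := by
    constructor
    · refine lt_of_le_of_ne hwm.1 fun h => ?_
      linarith [hside t w ht htτ (by rw [← h]; ring)]
    · refine lt_of_le_of_ne hwm.2 fun h => ?_
      linarith [hside t w ht htτ (by rw [h])]
  have hxx : pxx t w - μ * ((2 * (k + 16 * k ^ 2 * t) + 4 * (k + 16 * k ^ 2 * t) ^ 2 * w ^ 2) *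
      gaussianBarrier k t w) ≤ 0 := by
    refine second_deriv_nonpos_of_isLocalMax (f := fun w => p t w - μ * gaussianBarrier k t w)
      (fun w => (dx t w ht).sub ((hasDerivAt_gaussianBarrier_w k t w).const_mul μ))
      ((dxx t w ht).sub ((hasDerivAt_gaussianBarrier_ww k t w).const_mul μ)) ?_
    filter_upwards [Ioo_mem_nhds hwL.1 hwL.2] with y hy
    have h : f (t, y) ≤ f (t, w) :=
      hmax (show (t, y) ∈ Icc 0 t₁ ×ˢ Icc (-L) L from ⟨htm, hy.1.le, hy.2.le⟩)
    simpa only [f, if_pos ht] using h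
  have hpt : 0 ≤ pt t w - μ * ((16 * k ^ 2 * w ^ 2 + 5 * k) * gaussianBarrier k t w) := by
    refine deriv_nonneg_of_left_max
      ((dt t w ht).sub ((hasDerivAt_gaussianBarrier_t k t w).const_mul μ)) ?_
    filter_upwards [Ioo_mem_nhdsLT ht] with s hs
    have h : f (s, w) ≤ f (t, w) := hmax (show (s, w) ∈ Icc 0 t₁ ×ˢ Icc (-L) L from
      ⟨⟨hs.1.le, hs.2.le.trans htm.2⟩, hwm⟩)
    simpa only [f, if_pos ht, if_pos hs.1, Pi.sub_apply] using h
  -- At the maximum `p` exceeds a positive barrier, so the subsolution inequality applies. With `B`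
  -- the barrier, `pₜ ≤ p_ww ≤ μ B_ww < μ Bₜ ≤ pₜ`, a contradiction.
  have h1 := sub t w ht (by linarith)
  have h2 := mul_lt_mul_of_pos_left
    (gaussianBarrier_strict w hk ht.le ((by gcongr : 16 * k * t ≤ 16 * k * τ).trans hτ)) hμ
  linarith

/-- `D` solves `∂ₜ D = ∂_w² D - q D` for `t > 0` and is continuous there. -/
structure IsSchrodingerHeat (q : ℝ → ℝ) (D Dt Dx Dxx : ℝ → ℝ → ℂ) : Prop where
  dt : ∀ t w, 0 < t → HasDerivAt (fun t => D t w) (Dt t w) t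
  dx : ∀ t w, 0 < t → HasDerivAt (D t) (Dx t w) w
  dxx : ∀ t w, 0 < t → HasDerivAt (Dx t) (Dxx t w) w
  eq : ∀ t w, 0 < t → Dt t w = Dxx t w - q w * D t w
  cont : ContinuousOn (fun v : ℝ × ℝ => D v.1 v.2) (Ioi 0 ×ˢ univ)

namespace IsSchrodingerHeat

variable {q : ℝ → ℝ} {D Dt Dx Dxx : ℝ → ℝ → ℂ}

theorem sub {D' Dt' Dx' Dxx' : ℝ → ℝ → ℂ} (h : IsSchrodingerHeat q D Dt Dx Dxx)
    (h' : IsSchrodingerHeat q D' Dt' Dx' Dxx') :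
    IsSchrodingerHeat q (fun t w => D t w - D' t w) (fun t w => Dt t w - Dt' t w)
      (fun t w => Dx t w - Dx' t w) (fun t w => Dxx t w - Dxx' t w) where
  dt t w ht := (h.dt t w ht).sub (h'.dt t w ht)
  dx t w ht := (h.dx t w ht).sub (h'.dx t w ht)
  dxx t w ht := (h.dxx t w ht).sub (h'.dxx t w ht)
  eq t w ht := by
    rw [h.eq t w ht, h'.eq t w ht]
    ring
  cont := h.cont.sub h'.cont

theorem shift (h : IsSchrodingerHeat q D Dt Dx Dxx) {t₀ : ℝ} (ht₀ : 0 ≤ t₀) :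
    IsSchrodingerHeat q (fun t w => D (t + t₀) w) (fun t w => Dt (t + t₀) w)
      (fun t w => Dx (t + t₀) w) (fun t w => Dxx (t + t₀) w) where
  dt t w ht := (h.dt (t + t₀) w (by linarith)).comp_add_const t t₀
  dx t w ht := h.dx (t + t₀) w (by linarith)
  dxx t w ht := h.dxx (t + t₀) w (by linarith)
  eq t w ht := h.eq (t + t₀) w (by linarith)
  cont := h.cont.comp (by fun_prop : ContinuousOn (fun v : ℝ × ℝ => (v.1 + t₀, v.2)) _)
    fun v hv => ⟨add_pos_of_pos_of_nonneg hv.1 ht₀, mem_univ _⟩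

/-- The real principle is applied to `Re(ζ D)`, with `ζ` the conjugate of the value of `D` at the
given point, where it equals `|D|²`. Because `q ≥ 0`, this is a subsolution of the free heat
equation wherever it is positive. -/
theorem eq_zero_short (h : IsSchrodingerHeat q D Dt Dx Dxx) (hq : ∀ w, 0 ≤ q w) {k τ C c : ℝ}
    (hk : 0 < k) (hτ : 16 * k * τ ≤ 1) (hck : c + 1 ≤ k)
    (init : ∀ w₀, Tendsto (fun v : ℝ × ℝ => D v.1 v.2) (𝓝[Ioi 0] 0 ×ˢ 𝓝 w₀) (𝓝 0))
    (growth : ∀ t w, 0 < t → t ≤ τ → ‖D t w‖ ≤ C * exp (c * w ^ 2)) {t w : ℝ} (ht : 0 < t)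
    (htτ : t ≤ τ) : D t w = 0 := by
  set ζ : ℂ := (starRingEnd ℂ) (D t w) with hζ
  let ℓ : ℂ →L[ℝ] ℝ := Complex.reCLM.comp (ContinuousLinearMap.mul ℝ ℂ ζ)
  have hℓ : ∀ z, ℓ z = (ζ * z).re := fun z => rfl
  have key : ℓ (D t w) ≤ 0 := by
    refine heat_maximum_principle (p := fun t w => ℓ (D t w)) (pt := fun t w => ℓ (Dt t w))
      (px := fun t w => ℓ (Dx t w)) (pxx := fun t w => ℓ (Dxx t w)) (C := ‖ζ‖ * C) hk hτ hck
      (fun t w ht => ℓ.hasFDerivAt.comp_hasDerivAt t (h.dt t w ht))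
      (fun t w ht => ℓ.hasFDerivAt.comp_hasDerivAt w (h.dx t w ht))
      (fun t w ht => ℓ.hasFDerivAt.comp_hasDerivAt w (h.dxx t w ht)) ?_
      (ℓ.continuous.comp_continuousOn h.cont) ?_ ?_ ht htτ
    · intro t w ht hpos
      have h1 : ℓ (Dt t w) = ℓ (Dxx t w) - q w * ℓ (D t w) := by
        rw [h.eq t w ht, map_sub, ← Complex.real_smul, map_smul, smul_eq_mul]
      rw [h1]
      have := mul_nonneg (hq w) hpos.le
      linarith
    · intro w₀
      simpa [Function.comp_def] using (ℓ.continuous.tendsto 0).comp (init w₀)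
    · intro t w ht htτ
      rw [hℓ, mul_assoc]
      calc (ζ * D t w).re ≤ ‖ζ * D t w‖ := Complex.re_le_norm _
        _ = ‖ζ‖ * ‖D t w‖ := norm_mul _ _
        _ ≤ _ := by
          gcongr
          exact growth t w ht htτ
  rw [hℓ, hζ, ← Complex.normSq_eq_conj_mul_self, Complex.ofReal_re] at key
  exact Complex.normSq_eq_zero.1 (le_antisymm key (Complex.normSq_nonneg _))

/-- Uniqueness in the class of functions of Gaussian growth. -/
theorem eq_zero (h : IsSchrodingerHeat q D Dt Dx Dxx) (hq : ∀ w, 0 ≤ q w) {T C c : ℝ}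
    (hT : 0 < T)
    (init : ∀ w₀, Tendsto (fun v : ℝ × ℝ => D v.1 v.2) (𝓝[Ioi 0] 0 ×ˢ 𝓝 w₀) (𝓝 0))
    (growth : ∀ t w, 0 < t → t ≤ T → ‖D t w‖ ≤ C * exp (c * w ^ 2)) (w : ℝ) : D T w = 0 := by
  set k : ℝ := |c| + 1 with hk_def
  have hk : 0 < k := by positivity
  have hck : c + 1 ≤ k := by linarith [le_abs_self c]
  -- The interval is cut into `N` steps of length at most `1/(16k)`. The growth bound is uniform on
  -- `(0, T]`, so the same `k` serves in every step.
  obtain ⟨N, hN⟩ := exists_nat_gt (16 * k * T)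
  have hN0 : (0 : ℝ) < N := lt_trans (by positivity) hN
  set τ : ℝ := T / N with hτ_def
  have hτ0 : 0 < τ := by positivity
  have hNτ : N * τ = T := by
    rw [hτ_def]
    field_simp
  have hτ : 16 * k * τ ≤ 1 := by
    rw [hτ_def, ← mul_div_assoc, div_le_one hN0]
    exact hN.le
  have claim : ∀ n : ℕ, n ≤ N → ∀ t w, 0 < t → t ≤ n * τ → D t w = 0 := by
    intro n
    induction n with
    | zero =>
      intro _ t w ht htn
      simp at htn
      linarith
    | succ n ih =>
      intro hn t w ht htn
      have ih' := ih (by omega)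
      rcases le_or_gt t (n * τ) with hle | hlt
      · exact ih' t w ht hle
      have hnτ : 0 ≤ n * τ := by positivity
      have hnT : (n : ℝ) * τ + τ ≤ T := by
        rw [← hNτ, ← add_one_mul]
        have : (n : ℝ) + 1 ≤ N := by exact_mod_cast hn
        gcongr
      have h1 := (h.shift hnτ).eq_zero_short hq (t := t - n * τ) (w := w) hk hτ hck ?_
        (fun s y hs hsτ => growth (s + n * τ) y (by linarith) (by linarith)) (by linarith)
        (by push_cast at htn; linarith)
      · simpa using h1
      -- The solution restarts at time `nτ` with zero data: the original initial condition when `nτ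
      -- = 0`, otherwise the vanishing from the previous step together with continuity.
      · intro w₀
        rcases hnτ.eq_or_lt with h0 | h0
        · simpa [← h0] using init w₀
        · have h2 := h.cont.continuousAt (x := (n * τ, w₀))
            ((isOpen_Ioi.prod isOpen_univ).mem_nhds ⟨h0, mem_univ _⟩)
          have h3 : Tendsto (fun v : ℝ × ℝ => (v.1 + n * τ, v.2)) (𝓝[Ioi 0] 0 ×ˢ 𝓝 w₀)
              (𝓝 (n * τ, w₀)) := by
            have h4 : Continuous fun v : ℝ × ℝ => (v.1 + n * τ, v.2) := by fun_prop
            have h5 := h4.tendsto (0, w₀)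
            simp only [zero_add] at h5
            refine h5.mono_left ?_
            rw [nhds_prod_eq]
            exact prod_mono nhdsWithin_le_nhds le_rfl
          have h6 := h2.tendsto.comp h3
          simp only [ih' (n * τ) w₀ h0 le_rfl] at h6
          exact h6
  exact claim N le_rfl T w hT hNτ.ge

end IsSchrodingerHeat

theorem IsHeatBesselSolution.isSchrodingerHeat {a : ℝ} {u₀ : ℝ → ℂ} {v : ℝ → ℝ → ℂ}
    (h : IsHeatBesselSolution a u₀ v) :
    IsSchrodingerHeat (fun w => a ^ 2 * exp w ^ 2) (fun t w => v t (exp w))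
      (fun t w => deriv (fun τ => v τ (exp w)) t) (fun t w => exp w * deriv (v t) (exp w))
      (fun t w => exp w * deriv (v t) (exp w) +
        exp w * (exp w * deriv (deriv (v t)) (exp w))) where
  dt t w ht := (h.diff_t t _ ht (exp_pos w)).hasDerivAt
  dx t w ht := by
    have h1 := (h.diff_x t _ ht (exp_pos w)).hasDerivAt.scomp w (hasDerivAt_exp w)
    simpa [Function.comp_def] using h1
  dxx t w ht := by
    have h1 := (h.diff_xx t _ ht (exp_pos w)).hasDerivAt.scomp w (hasDerivAt_exp w)
    refine ((hasDerivAt_exp w).ofReal_comp.mul h1).congr_deriv ?_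
    simp
  eq t w ht := by
    rw [← h.heat t _ ht (exp_pos w), besselOp]
    push_cast
    ring
  cont := by
    -- Joint continuity of `v` itself is not part of the definition of a solution; it follows from
    -- the continuous first partial derivatives.
    have hc : ContinuousOn (fun p : ℝ × ℝ => v p.1 p.2) (Ioi 0 ×ˢ Ioi 0) := by
      intro p hp
      have hmem := (isOpen_Ioi.prod isOpen_Ioi).mem_nhds hp
      refine (hasStrictFDerivAt_of_partial (f := v) (f₁ := fun t x => deriv (fun τ => v τ x) t)
        (f₂ := fun t x => deriv (v t) x) ?_ ?_ (h.cont_t.continuousAt hmem)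
        (h.cont_x.continuousAt hmem)).hasFDerivAt.continuousAt.continuousWithinAt
      · filter_upwards [hmem] with y hy using (h.diff_t _ _ hy.1 hy.2).hasDerivAt
      · filter_upwards [hmem] with y hy using (h.diff_x _ _ hy.1 hy.2).hasDerivAt
    exact hc.comp (by fun_prop : ContinuousOn (fun p : ℝ × ℝ => (p.1, exp p.2)) _)
      fun p hp => ⟨hp.1, exp_pos _⟩

theorem IsHeatBesselSolution.unique {a : ℝ} {u₀ : ℝ → ℂ} {u v : ℝ → ℝ → ℂ}
    (hu : IsHeatBesselSolution a u₀ u) (hv : IsHeatBesselSolution a u₀ v)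
    (gu : HasLogGaussianGrowth u) (gv : HasLogGaussianGrowth v) {t x : ℝ} (ht : 0 < t)
    (hx : 0 < x) : v t x = u t x := by
  obtain ⟨C, c, hC⟩ := gv t ht
  obtain ⟨C', c', hC'⟩ := gu t ht
  have hexp : ∀ w₀ : ℝ, Tendsto (fun p : ℝ × ℝ => (p.1, exp p.2)) (𝓝[Ioi 0] 0 ×ˢ 𝓝 w₀)
      (𝓝[Ioi 0] 0 ×ˢ 𝓝 (exp w₀)) := fun w₀ =>
    tendsto_fst.prodMk ((continuous_exp.tendsto w₀).comp tendsto_snd)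
  have h := (hv.isSchrodingerHeat.sub hu.isSchrodingerHeat).eq_zero (fun w => by positivity) ht
    -- The growth constants come without sign, hence the absolute values.
    (C := |C| + |C'|) (c := max c c') (fun w₀ => ?_) (fun s w hs hst => ?_) (log x)
  · simp only [exp_log hx] at h
    exact sub_eq_zero.1 h
  · have h1 := (hv.initial _ (exp_pos w₀)).comp (hexp w₀)
    have h2 := (hu.initial _ (exp_pos w₀)).comp (hexp w₀)
    simpa using h1.sub h2
  · have h1 := hC s _ hs hst (exp_pos w)
    have h2 := hC' s _ hs hst (exp_pos w)
    rw [log_exp] at h1 h2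
    rw [add_mul]
    refine (norm_sub_le _ _).trans (add_le_add (h1.trans ?_) (h2.trans ?_))
    · exact mul_le_mul (le_abs_self C) (exp_le_exp.2 (by gcongr; exact le_max_left _ _))
        (exp_pos _).le (abs_nonneg _)
    · exact mul_le_mul (le_abs_self C') (exp_le_exp.2 (by gcongr; exact le_max_right _ _))
        (exp_pos _).le (abs_nonneg _)

end

/-! ### Assembly of the theorem. -/

theorem contDiff_div_ofReal {u₀ : ℝ → ℂ} (hu : ContDiff ℝ 1 u₀) (hsupp : tsupport u₀ ⊆ Set.Ioi 0) :
    ContDiff ℝ 1 fun y : ℝ => u₀ y / y := by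
  refine contDiff_iff_contDiffAt.2 fun y => ?_
  -- On the support `y > 0`, so `1/y` is smooth there; off the support the quotient vanishes nearby,
  -- in particular around `y = 0`.
  by_cases hy : y ∈ tsupport u₀
  · have h : (0 : ℝ) < y := hsupp hy
    have h0 : Complex.ofRealCLM y ≠ 0 := by simpa using h.ne'
    simp_rw [div_eq_mul_inv]
    exact hu.contDiffAt.mul (Complex.ofRealCLM.contDiff.contDiffAt.inv h0)
  · refine (contDiffAt_const (c := (0 : ℂ))).congr_of_eventuallyEq ?_
    filter_upwards [notMem_tsupport_iff_eventuallyEq.1 hy] with z hz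
    simp [hz]

theorem hasCompactSupport_div_ofReal {u₀ : ℝ → ℂ} (h : HasCompactSupport u₀) :
    HasCompactSupport fun y : ℝ => u₀ y / y :=
  h.mono fun _ hy h0 => hy (by simp [h0])

theorem theorem4 (a : ℝ) :
    -- the kernel is given by absolutely convergent integrals
    (∀ t x x' : ℝ, 0 < t → 0 < x → 0 < x' →
      MeasureTheory.IntegrableOn (heatBesselIntegrand a t x x') (heatBesselRange x x')) ∧
    -- the kernel is the partial Fourier transform of the heat kernel of the hyperbolic plane
    (∀ (t x x' y' : ℝ) (_ : 0 < t) (hx : 0 < x) (hx' : 0 < x'),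
      (∀ z z' : UpperHalfPlane,
        MeasureTheory.IntegrableOn (hyperbolicHeatIntegrand t (dist z z'))
          (Set.Ioi (dist z z'))) ∧
      MeasureTheory.Integrable (fun y : ℝ =>
        hyperbolicHeatKernel t (UpperHalfPlane.mk ⟨y, x⟩ hx) (UpperHalfPlane.mk ⟨y', x'⟩ hx')) ∧
      (heatBesselKernel a t x x' : ℂ) =
        1 / (Real.sqrt (x * x') : ℂ) *
          ∫ y : ℝ, Complex.exp (-Complex.I * (a : ℂ) * ((y - y' : ℝ) : ℂ)) *
            (hyperbolicHeatKernel t (UpperHalfPlane.mk ⟨y, x⟩ hx)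
              (UpperHalfPlane.mk ⟨y', x'⟩ hx') : ℂ)) ∧
    -- the heat Cauchy problem has the solution given by the kernel, and no other
    (∀ u₀ : ℝ → ℂ, ContDiff ℝ (⊤ : ℕ∞) u₀ → HasCompactSupport u₀ → tsupport u₀ ⊆ Set.Ioi 0 →
      (∀ t x : ℝ, 0 < t → 0 < x →
        MeasureTheory.IntegrableOn
          (fun x' : ℝ => (heatBesselKernel a t x x' : ℂ) * u₀ x' / (x' : ℂ)) (Set.Ioi 0)) ∧
      IsHeatBesselSolution a u₀ (heatBesselFlow a u₀) ∧
      (∃ M : ℝ, ∀ t x : ℝ, 0 < t → 0 < x → ‖heatBesselFlow a u₀ t x‖ ≤ M) ∧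
      (∀ v : ℝ → ℝ → ℂ, IsHeatBesselSolution a u₀ v → HasLogGaussianGrowth v →
        ∀ t x : ℝ, 0 < t → 0 < x → v t x = heatBesselFlow a u₀ t x)) := by
  refine ⟨fun t x x' ht _ _ => (integrable_heatBesselIntegrand a x x' ht).integrableOn,
    fun t x x' y' ht hx hx' => ⟨fun z z' => integrableOn_hyperbolicHeatIntegrand ht dist_nonneg,
      integrable_hyperbolicHeatKernel ht y' hx hx', heatBesselKernel_eq_fourier a ht y' hx hx'⟩,
    fun u₀ hu hcs hsupp => ?_⟩
  have hV := contDiff_div_ofReal (hu.of_le (by simp)) hsupp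
  have hVcs := hasCompactSupport_div_ofReal hcs
  have hVi : MeasureTheory.Integrable fun y : ℝ => u₀ y / y :=
    hV.continuous.integrable_of_hasCompactSupport hVcs
  obtain ⟨M, hM⟩ := hu.continuous.bounded_above_of_compact_support hcs
  obtain ⟨B, hB⟩ := hV.continuous.bounded_above_of_compact_support hVcs
  obtain ⟨B', hB'⟩ := (hV.continuous_deriv le_rfl).bounded_above_of_compact_support hVcs.deriv
  have hsol : IsHeatBesselSolution a u₀ (heatBesselFlow a u₀) :=
    (isWaveSolution_waveW hV hB hB' a).isHeatBesselSolution
      (fun t x ht hx => heatBesselFlow_eq_heatTransform hVi ht hx)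
      (fun x₀ hx₀ => tendsto_heatBesselFlow hu.continuous hV.continuous hVi hM a hx₀)
  have hbound : ∀ t x : ℝ, 0 < t → 0 < x → ‖heatBesselFlow a u₀ t x‖ ≤ M := fun t x ht hx =>
    norm_heatBesselFlow_le hV.continuous hVi hM ht hx
  -- The flow is bounded, so it belongs to the uniqueness class with exponent `c = 0`.
  refine ⟨fun t x ht hx => integrableOn_heatBesselKernel_mul hVi ht hx, hsol, ⟨M, hbound⟩,
    fun v hv hg t x ht hx => hsol.unique hv (fun T _ => ⟨M, 0, fun t x ht _ hx => ?_⟩) hg ht hx⟩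
  simpa using hbound t x ht hx
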